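/- Let $h\neq0$ and $\kappa$ be real with $\sin(\kappa h)\neq 0$, and consider the differential-difference equation of the Burgers hierarchy $$\partial_t u_n=\frac1{2h}\Big\{(1+hu_n)(u_{n+1}-u_n)-\frac{u_{n-1}-u_n}{1+hu_{n-1}}\Big\}.$$ Substitute the formal multiple-scale expansion $u_n(t)=\sum_{\gamma\ge1}\sum_{|\theta|\le\gamma}\epsilon^\gamma u_\gamma^{(\theta)}e^{i\theta(\kappa hn-\omega t)}$, $u_\gamma^{(-\theta)}=\overline{u_\gamma^{(\theta)}}$, where $\omega$ is real and the amplitudes depend on the slow variables $n_1=\epsilon n$, $t_s=\epsilon^st$. Write $u(j)=u_j^{(1)}$, $\partial=\partial_{n_1}$; the $u(j)$ are treated as independent differential variables, and all amplitudes are differential polynomials in the $u(j)$, $\bar u(j)$ without constant term (decay at infinity). Let $\mathcal P_\nu(\mu)$ be the space of nonlinear differential polynomials in $u(j),\bar u(j)$, $1\le j\le\mu$, that are of gauge $1$ (multiplied by $e^{i\varphi}$ under $u(j)\mapsto e^{i\varphi}u(j)$) and of total order $\nu$, where $\partial^m u(j)$ and $\partial^m\bar u(j)$ have order $m+j$. The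 expansion is called secularity-free up to order $\epsilon^5$ if every harmonic of the equation holds at the orders $\epsilon^0,\dots,\epsilon^5$; if $\partial_{t_1}u(j)=c\,\partial u(j)$ for all $j$ with one constant $c$; if, for $s\ge2$, $s+j\le5$, $\partial_{t_s}u(j)$ is a constant multiple of $\partial^su(j)$ plus an element of $\mathcal P_{s+j}(j)$; and if $\partial_{t_s}\partial_{t_r}u(j)=\partial_{t_r}\partial_{t_s}u(j)$ for $s,r\geq 1$ whenever $s+j\le5$ and $r+j\le5$. Put $B_s=\dfrac{\sin(\kappa h+s\pi/2)}{h\,s!}$, so $B_2=-\dfrac{\sin(\kappa h)}{2h}$, and $M_s=\partial_{t_s}-(-i)^{s-1}B_s\partial^s$. For $J\ge1$, an expansion up to order $\epsilon^5$ is called $A_J$ $C$-integrable if there are $f_s(j)\in\mathcal P_{s+j}(j-1)$ for $s\ge2$, $2\le j\le J$, such that its evolution equations with $j\le J$, $s\ge 2$, $s+j\le5$ are $M_su(1)=0$ and $M_su(j)=f_s(j)$, and such that $M_sf_{s'}(j)=M_{s'}f_s(j)$ for all $s,s'\ge2$ and $2\le j\le J$ (including the $f_s(j)$ with $s+j>5$),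 the time derivatives being eliminated by $M_su(1)=0$, $M_su(r)=f_s(r)$, $2\le r<j$. Then a secularity-free expansion up to order $\epsilon^5$ exists, and every such expansion satisfies: 1. $\omega=-\sin(\kappa h)/h$ and $\partial_{t_1}u(j)=\frac{\cos(\kappa h)}h\,\partial u(j)$ for all $j\ge 1$. 2. The amplitude $u(1)$ obeys the linear Schrödinger equation $i\,\partial_{t_2}u(1)=B_2\,\partial^2u(1)$; that is, $i\,\partial_{t_2}u(1)=\beta\,\partial^2u(1)+\rho_2|u(1)|^2u(1)$ holds exactly for $\beta=B_2$, $\rho_2=0$. The expansion is $A_1$ and $A_2$ $C$-integrable. 3. $M_2u(2)=a\,\partial u(1)|u(1)|^2+b\,\partial\bar u(1)\,u(1)^2$ holds exactly for $a=b=0$. 4. The expansion is $A_3$ $C$-integrable. Moreover there are complex constants $\tau_1,\dots,\tau_{12}$, the same for all such expansions, with $$\begin{aligned}M_2u(3)={}&\tau_1|u(1)|^4u(1)+\tau_2|\partial u(1)|^2u(1)+\tau_3|u(1)|^2\partial^2u(1)+\tau_4\,\partial^2\bar u(1)\,u(1)^2+\tau_5(\partial u(1))^2\bar u(1)\\&+\tau_6\,\partial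 u(2)|u(1)|^2+\tau_7\,\partial\bar u(2)\,u(1)^2+\tau_8u(2)^2\bar u(1)+\tau_9|u(2)|^2u(1)\\&+\tau_{10}u(2)\,\partial u(1)\,\bar u(1)+\tau_{11}u(2)\,\partial\bar u(1)\,u(1)+\tau_{12}\bar u(2)\,\partial u(1)\,u(1),\end{aligned}$$ which satisfy, with $a=b=0$, the $A_3$ $C$-integrability conditions $$\tau_1=-\tfrac{i}{4B_2}\big[b(\tau_{11}-2\tau_6)+\bar a\tau_7\big],\quad \bar b\tau_7=\tfrac12(b-a)(\tau_{11}+\tau_{10}-\tau_6)+\bar a\tau_7,\quad a\tau_8=b\tau_8=0,\quad a\tau_9=b\tau_9=0,$$ $$\bar a\tau_{12}=a(\tau_{10}-\tau_{11})+b\tau_6+\bar a\tau_7,\qquad(\bar b-\bar a)\tau_{12}=(b-a)\tau_{10}.$$ -/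

import Mathlib

open scoped LaurentPolynomial PowerSeries ComplexConjugate

noncomputable section

namespace MultiScale

/-! ### Differential polynomials in the first-harmonic amplitudes -/

/-- Jet variables: `(j, μ, false)` stands for `∂^μ u_j^{(1)}` and `(j, μ, true)` for its complex
conjugate, where `∂ = ∂_{n₁}` is the derivative in the slow space variable. -/
abbrev Jet : Type := ℕ+ × ℕ × Bool

/-- Differential polynomials with complex coefficients in the amplitudes `u_j^{(1)}`, `j ≥ 1`,
and their complex conjugates. -/
abbrev DiffPoly : Type := MvPolynomial Jet ℂ

/-- The amplitude `u(j) = u_j^{(1)}`. -/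
def u (j : ℕ+) : DiffPoly := MvPolynomial.X (j, 0, false)

/-- The total derivative `∂ = ∂_{n₁}`. -/
def dx : Derivation ℂ DiffPoly DiffPoly :=
  MvPolynomial.mkDerivation ℂ fun v => MvPolynomial.X (v.1, v.2.1 + 1, v.2.2)

/-- The iterated derivative `∂^k`. -/
def dxPow (k : ℕ) (p : DiffPoly) : DiffPoly := dx^[k] p

/-- Complex conjugation of differential polynomials. -/
def bar : DiffPoly →+* DiffPoly :=
  (MvPolynomial.rename (fun v : Jet => (v.1, v.2.1, !v.2.2)) :
      DiffPoly →ₐ[ℂ] DiffPoly).toRingHom.comp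
    (MvPolynomial.map (starRingEnd ℂ))

/-- The time derivative induced on differential polynomials by the evolution equations
`∂_t u_j = F j`, their `∂`-derivatives and their complex conjugates. -/
def evol (F : ℕ+ → DiffPoly) : Derivation ℂ DiffPoly DiffPoly :=
  MvPolynomial.mkDerivation ℂ fun v =>
    if v.2.2 then bar (dxPow v.2.1 (F v.1)) else dxPow v.2.1 (F v.1)

/-- Total order in `ε` of a monomial: `∂^μ u_j` and its conjugate have order `μ + j`. -/
def epsOrder (m : Jet →₀ ℕ) : ℕ := m.sum fun v k => k * (v.2.1 + (v.1 : ℕ))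

/-- Gauge of a monomial: under `u_j ↦ e^{iθ} u_j` it is multiplied by `e^{iθ · gauge}`. -/
def gaugeWeight (m : Jet →₀ ℕ) : ℤ := m.sum fun v k => if v.2.2 then -(k : ℤ) else (k : ℤ)

/-- The space `𝒫_ν(μ)`: nonlinear differential polynomials of gauge 1 and total order `ν` in
`u_j`, `1 ≤ j ≤ μ`, and their conjugates. -/
def P (ν μ : ℕ) : Submodule ℂ DiffPoly :=
  MvPolynomial.restrictSupport ℂ
    {m | epsOrder m = ν ∧ gaugeWeight m = 1 ∧ 2 ≤ m.degree ∧ ∀ v ∈ m.support, (v.1 : ℕ) ≤ μ}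

/-! ### The formal multiple-scale expansion -/

/-- Data of a formal multiple-scale expansion
`u_n(t) = ∑_{γ ≥ 1} ε^γ ∑_{|θ| ≤ γ} amp γ θ · e^{iθ(κ h n - ω t)}`.
The amplitudes depend on `n₁ = ε n` and `t_s = ε^s t`; their slow evolution is
`∂_{t_s} u_j^{(1)} = flow s j`. -/
structure Expansion where
  /-- frequency of the carrier wave -/
  ω : ℝ
  /-- amplitudes `u_γ^{(θ)}` -/
  amp : ℕ → ℤ → DiffPoly
  /-- `flow s j = ∂_{t_s} u_j^{(1)}` -/
  flow : ℕ → ℕ+ → DiffPoly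

/-- Formal series `∑_γ ε^γ ∑_{|θ| ≤ γ} c γ θ E^θ`, where `E = e^{i(κ h n - ω t)}` is the
Laurent variable. -/
def harmonicSeries (c : ℕ → ℤ → DiffPoly) : DiffPoly[T;T⁻¹]⟦X⟧ :=
  PowerSeries.mk fun γ => ∑ θ ∈ Finset.Icc (-(γ : ℤ)) γ,
    LaurentPolynomial.C (c γ θ) * LaurentPolynomial.T θ

namespace Expansion

/-- The expansion of `u_{n+σ}(t)`: the fast variable is shifted by `σ`, which multiplies `E^θ` by
`e^{iσθκh}`, and the slow variable `n₁` by `σ ε`, which acts as `exp (σ ε ∂_{n₁})`. -/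
def shifted (e : Expansion) (h κ : ℝ) (σ : ℤ) : DiffPoly[T;T⁻¹]⟦X⟧ :=
  harmonicSeries fun γ θ => ∑ k ∈ Finset.range (γ + 1),
    (((σ : ℂ) ^ k / (k.factorial : ℂ)) * Complex.exp (Complex.I * σ * θ * κ * h)) •
      dxPow k (e.amp (γ - k) θ)

/-- The expansion of `∂_t u_n(t)`, where `∂_t` becomes `∂_t + ∑_{s ≥ 1} ε^s ∂_{t_s}`. -/
def timeDeriv (e : Expansion) : DiffPoly[T;T⁻¹]⟦X⟧ :=
  harmonicSeries fun γ θ => (-(Complex.I * θ * e.ω)) • e.amp γ θ +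
    ∑ s ∈ Finset.Icc 1 γ, evol (e.flow s) (e.amp (γ - s) θ)

/-- The right-hand side of the differential-difference Burgers equation,
`(1/2h) {(1 + h u_n)(u_{n+1} - u_n) - (u_{n-1} - u_n) / (1 + h u_{n-1})}`,
as a formal series. -/
def burgersRHS (e : Expansion) (h κ : ℝ) : DiffPoly[T;T⁻¹]⟦X⟧ :=
  ((1 / (2 * h) : ℝ) : ℂ) •
    ((1 + (h : ℂ) • e.shifted h κ 0) * (e.shifted h κ 1 - e.shifted h κ 0) -
      (e.shifted h κ (-1) - e.shifted h κ 0) *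
        PowerSeries.invOfUnit (1 + (h : ℂ) • e.shifted h κ (-1)) 1)

/-- `e` is a secularity-free formal multiple-scale expansion of the differential-difference
Burgers equation up to and including order `ε^N`. -/
structure IsBurgersExpansion (e : Expansion) (h κ : ℝ) (N : ℕ) : Prop where
  /-- the expansion starts at order `ε` -/
  amp_zero : ∀ θ : ℤ, e.amp 0 θ = 0
  /-- only the harmonics `|θ| ≤ γ` occur at order `ε^γ` -/
  amp_support : ∀ (γ : ℕ) (θ : ℤ), (γ : ℤ) < |θ| → e.amp γ θ = 0
  /-- the first harmonics are the independent amplitudes -/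
  amp_one : ∀ j : ℕ+, e.amp j 1 = u j
  /-- reality of `u_n` -/
  amp_neg : ∀ (γ : ℕ) (θ : ℤ), e.amp γ (-θ) = bar (e.amp γ θ)
  /-- the amplitudes vanish as `n₁ → ±∞`, so they have no constant term -/
  amp_decay : ∀ (γ : ℕ) (θ : ℤ), MvPolynomial.constantCoeff (e.amp γ θ) = 0
  /-- all harmonics of the equation at the orders `ε^0, …, ε^N` -/
  equation : ∀ γ ≤ N,
    PowerSeries.coeff γ e.timeDeriv = PowerSeries.coeff γ (e.burgersRHS h κ)
  /-- no secular terms at the time `t₁`: the amplitudes depend on `n₁`, `t₁` through one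
  travelling variable only -/
  flow_one : ∃ c : ℂ, ∀ j, e.flow 1 j = c • dx (u j)
  /-- no secular terms at the times `t_s`, `s ≥ 2`: besides the dispersive term `∂^s u_j` the
  evolution of `u_j` contains no linear term (any such term would solve the homogeneous
  equation); the nonlinear terms are arbitrary -/
  flow_form : ∀ (s : ℕ) (j : ℕ+), 2 ≤ s → s + j ≤ N →
    ∃ l : ℂ, e.flow s j - l • dxPow s (u j) ∈ P (s + j) j
  /-- the partial derivatives with respect to different slow times commute -/
  flow_comm : ∀ (s r : ℕ) (j : ℕ+), 1 ≤ s → 1 ≤ r → s + j ≤ N → r + j ≤ N →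
    evol (e.flow s) (e.flow r j) = evol (e.flow r) (e.flow s j)

end Expansion

/-! ### Asymptotic `C`-integrability -/

/-- The `s`-th flow `(-i)^{s-1} B_s ∂^s p` of the linear Schrödinger hierarchy. -/
def linFlow (B : ℕ → ℝ) (s : ℕ) (p : DiffPoly) : DiffPoly :=
  ((-Complex.I) ^ (s - 1) * (B s : ℂ)) • dxPow s p

/-- The operator `M_s = ∂_{t_s} - (-i)^{s-1} B_s ∂^s` on differential polynomials, with the
`t_s`-derivatives eliminated by means of `M_s u_j = f s j`. -/
def M (B : ℕ → ℝ) (f : ℕ → ℕ+ → DiffPoly) (s : ℕ) (p : DiffPoly) : DiffPoly :=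
  evol (fun j => linFlow B s (u j) + f s j) p - linFlow B s p

/-- `A_J` `C`-integrability of an expansion carried out up to order `ε^N`: its evolution equations
are `M_s u_1 = 0` and `M_s u_j = f_s(j)`, with `f_s(j) ∈ 𝒫_{s+j}(j-1)`, `2 ≤ j ≤ J`, where the
forcing terms, including those beyond order `ε^N`, satisfy all the compatibility conditions
`M_s f_{s'}(j) = M_{s'} f_s(j)`. -/
def IsAsymptoticallyCIntegrable (e : Expansion) (N : ℕ) (B : ℕ → ℝ) (J : ℕ) : Prop :=
  ∃ f : ℕ → ℕ+ → DiffPoly,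
    (∀ s, f s 1 = 0) ∧
    (∀ (s : ℕ) (j : ℕ+), 2 ≤ s → 2 ≤ j → (j : ℕ) ≤ J → f s j ∈ P (s + j) (j - 1)) ∧
    (∀ (s : ℕ) (j : ℕ+), 2 ≤ s → (j : ℕ) ≤ J → s + j ≤ N →
      e.flow s j = linFlow B s (u j) + f s j) ∧
    (∀ (s s' : ℕ) (j : ℕ+), 2 ≤ s → 2 ≤ s' → 2 ≤ j → (j : ℕ) ≤ J →
      M B f s (f s' j) = M B f s' (f s j))

/-- The amplitude `u(1)` satisfies `i ∂_{t₂} u = β ∂² u + ρ |u|² u`. -/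
def LowestOrderNLS (e : Expansion) (β ρ : ℂ) : Prop :=
  Complex.I • e.flow 2 1 = β • dxPow 2 (u 1) + ρ • (u 1 * bar (u 1) * u 1)

/-- The general element of `𝒫_4(1)`: the forcing term `f_2(2)` with coefficients `a`, `b`. -/
def forcing22 (a b : ℂ) : DiffPoly :=
  a • (dx (u 1) * (u 1 * bar (u 1))) + b • (bar (dx (u 1)) * u 1 ^ 2)

/-- The general element of `𝒫_5(2)`: the forcing term `f_2(3)` with coefficients
`τ 1, …, τ 12`. -/
def forcing23 (τ : ℕ → ℂ) : DiffPoly :=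
  τ 1 • ((u 1 * bar (u 1)) ^ 2 * u 1) +
  τ 2 • (dx (u 1) * bar (dx (u 1)) * u 1) +
  τ 3 • (u 1 * bar (u 1) * dxPow 2 (u 1)) +
  τ 4 • (bar (dxPow 2 (u 1)) * u 1 ^ 2) +
  τ 5 • (dx (u 1) ^ 2 * bar (u 1)) +
  τ 6 • (dx (u 2) * (u 1 * bar (u 1))) +
  τ 7 • (bar (dx (u 2)) * u 1 ^ 2) +
  τ 8 • (u 2 ^ 2 * bar (u 1)) +
  τ 9 • (u 2 * bar (u 2) * u 1) +
  τ 10 • (u 2 * dx (u 1) * bar (u 1)) +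
  τ 11 • (u 2 * bar (dx (u 1)) * u 1) +
  τ 12 • (bar (u 2) * dx (u 1) * u 1)

/-- The explicit `A_3` `C`-integrability conditions on the coefficients of `f_2(2)` and
`f_2(3)`. -/
structure A3Conditions (B₂ : ℝ) (a b : ℂ) (τ : ℕ → ℂ) : Prop where
  cond1 : τ 1 = -(Complex.I / (4 * (B₂ : ℂ))) * (b * (τ 11 - 2 * τ 6) + conj a * τ 7)
  cond2 : conj b * τ 7 = 1 / 2 * (b - a) * (τ 11 + τ 10 - τ 6) + conj a * τ 7
  cond3 : a * τ 8 = 0 ∧ b * τ 8 = 0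
  cond4 : a * τ 9 = 0 ∧ b * τ 9 = 0
  cond5 : conj a * τ 12 = a * (τ 10 - τ 11) + b * τ 6 + conj a * τ 7
  cond6 : (conj b - conj a) * τ 12 = (b - a) * τ 10

/-- The dispersion coefficients of the Burgers equation with respect to `n₁`:
`B_s = -(1 / (s! h^s)) d^s ω / dκ^s` for `ω(κ) = -sin (κ h) / h`. -/
def burgersB (h κ : ℝ) (s : ℕ) : ℝ :=
  Real.sin (κ * h + s * (Real.pi / 2)) / (h * s.factorial)

end MultiScale

end

open scoped LaurentPolynomial PowerSeries ComplexConjugate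

noncomputable section

namespace MultiScale

/-! ### Derivations and conjugation on differential polynomials -/

/-! The equation is linearised by the discrete Hopf–Cole substitution `1 + h u_n = p_{n+1} / p_n`:
if `∂_t p_n = (p_{n+1} - p_{n-1}) / (2h)`, then `u_n` solves the Burgers equation, and an error
`O(ε^m)` in the linear equation stays `O(ε^m)` (`timeD_hopfCole`).

Existence. Take `p = 1 + ∑ ε^j (W_j E + c.c.)`. The first harmonic of `u_n` at order `ε^j` is `h⁻¹
(e^{iκh} - 1) W_j` plus terms in the `W_i`, `i < j`, so the `W_j` can be solved for recursively in
such a way that the first harmonics are the free amplitudes `u(j)` (`hopfAmp`). The linear equation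
for `p` holds as soon as every `W_j` follows the linear Schrödinger hierarchy, whose coefficients
are the expansion coefficients of the dispersion relation (`dispersion_coeff`). For `s ≥ 2` the
orders up to `ε^5` only see `j ≤ 3`, and by order and gauge the only nonlinear monomial in `W_1,
W_2, W_3` is `|u(1)|² u(1)`. Hence `u(1)` and `u(2)` evolve linearly, and `M_s u(3) = c M_s (|u(1)|²
u(1))` for a constant `c` (`evol_hopfAmp`). Such forcings are compatible because linear flows
commute (`linM_comm`); also `τ_1 = 0`, which is all that the `A_3` conditions demand when `a = b =
0`.

Uniqueness (`agreesUpTo`). Any expansion is compared with this one by induction on the order,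
through the first variation of the equation (`cf_burgersOp_sub`). The zeroth harmonic gives `(cos κh
- 1) ∂(difference of means) = 0`. A harmonic `θ ≥ 2` is multiplied by `θ sin κh - sin θκh`, which is
nonzero when `sin κh ≠ 0`. The first harmonic only says that the discrepancies of the flows `∂_{t_s}
u(j)` with `s + j = m + 1` add up to zero. Their linear parts are independent. For `s ≥ 3` the
nonlinear part vanishes because the flow commutes with the linear `t_2`-flow and the Schrödinger
operator is injective on nonlinear polynomials of gauge 1 (`eq_zero_of_schroedinger`). The `t_2`
discrepancy is then the only term left in the sum. -/

@[simp]
theorem dx_X (v : Jet) :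
    dx (MvPolynomial.X v) = MvPolynomial.X (v.1, v.2.1 + 1, v.2.2) := by
  simp [dx]

@[simp]
theorem bar_X (v : Jet) : bar (MvPolynomial.X v) = MvPolynomial.X (v.1, v.2.1, !v.2.2) := by
  simp [bar]

@[simp]
theorem bar_C (a : ℂ) : bar (MvPolynomial.C a) = MvPolynomial.C (conj a) := by
  simp [bar]

theorem bar_smul (a : ℂ) (p : DiffPoly) : bar (a • p) = conj a • bar p := by
  simp [MvPolynomial.smul_eq_C_mul]

@[simp]
theorem bar_bar (p : DiffPoly) : bar (bar p) = p := by
  induction p using MvPolynomial.induction_on with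
  | C a => simp
  | add p q hp hq => simp [hp, hq]
  | mul_X p v hp => simp [hp]

theorem dx_bar (p : DiffPoly) : dx (bar p) = bar (dx p) := by
  induction p using MvPolynomial.induction_on with
  | C a => simp
  | add p q hp hq => simp [hp, hq]
  | mul_X p v hp => simp [hp]

theorem dxPow_succ (k : ℕ) (p : DiffPoly) : dxPow (k + 1) p = dx (dxPow k p) :=
  Function.iterate_succ_apply' _ _ _

@[simp]
theorem dxPow_zero (p : DiffPoly) : dxPow 0 p = p := rfl

@[simp]
theorem dxPow_one (p : DiffPoly) : dxPow 1 p = dx p := rfl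

theorem dxPow_add (k l : ℕ) (p : DiffPoly) : dxPow (k + l) p = dxPow k (dxPow l p) :=
  Function.iterate_add_apply _ _ _ _

theorem dxPow_comm (k l : ℕ) (p : DiffPoly) : dxPow k (dxPow l p) = dxPow l (dxPow k p) := by
  rw [← dxPow_add, add_comm, dxPow_add]

/-- `∂^k` as a linear map. -/
def dxPowₗ (k : ℕ) : DiffPoly →ₗ[ℂ] DiffPoly := (dx : DiffPoly →ₗ[ℂ] DiffPoly) ^ k

theorem dxPowₗ_apply (k : ℕ) (p : DiffPoly) : dxPowₗ k p = dxPow k p := by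
  simp [dxPowₗ, dxPow, Module.End.pow_apply]

@[simp]
theorem dxPow_smul (k : ℕ) (a : ℂ) (p : DiffPoly) : dxPow k (a • p) = a • dxPow k p := by
  simp [← dxPowₗ_apply]

@[simp]
theorem dxPow_map_add (k : ℕ) (p q : DiffPoly) : dxPow k (p + q) = dxPow k p + dxPow k q := by
  simp [← dxPowₗ_apply]

@[simp]
theorem dxPow_map_sub (k : ℕ) (p q : DiffPoly) : dxPow k (p - q) = dxPow k p - dxPow k q := by
  simp [← dxPowₗ_apply]

@[simp]
theorem dxPow_map_zero (k : ℕ) : dxPow k 0 = 0 := by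
  simp [← dxPowₗ_apply]

@[simp]
theorem dxPow_X (k : ℕ) (v : Jet) :
    dxPow k (MvPolynomial.X v) = MvPolynomial.X (v.1, v.2.1 + k, v.2.2) := by
  induction k with
  | zero => simp
  | succ k ih => rw [dxPow_succ, ih, dx_X, add_assoc]

theorem dxPow_u (k : ℕ) (j : ℕ+) : dxPow k (u j) = MvPolynomial.X (j, k, false) := by
  simp [u]

theorem dxPow_bar (k : ℕ) (p : DiffPoly) : dxPow k (bar p) = bar (dxPow k p) := by
  induction k with
  | zero => simp
  | succ k ih => rw [dxPow_succ, dxPow_succ, ih, dx_bar]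

/-- The Leibniz rule for the divided powers of `∂`. -/
theorem dxPow_mul (k : ℕ) (p q : DiffPoly) :
    dxPow k (p * q) = ∑ ij ∈ Finset.HasAntidiagonal.antidiagonal k,
      (k.choose ij.1) • (dxPow ij.1 p * dxPow ij.2 q) := by
  induction k with
  | zero => simp
  | succ n ih =>
    rw [Finset.sum_antidiagonal_choose_succ_nsmul (M := DiffPoly)
      (fun i j => dxPow i p * dxPow j q) n, dxPow_succ, ih, map_sum, ← Finset.sum_add_distrib]
    refine Finset.sum_congr rfl fun ij h => ?_
    rw [map_nsmul, Derivation.leibniz, dxPow_succ, dxPow_succ,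
      Nat.choose_symm_of_eq_add (Finset.HasAntidiagonal.mem_antidiagonal.mp h).symm]
    simp only [smul_eq_mul, smul_add]
    ring_nf

theorem evol_X (F : ℕ+ → DiffPoly) (v : Jet) :
    evol F (MvPolynomial.X v) =
      if v.2.2 then bar (dxPow v.2.1 (F v.1)) else dxPow v.2.1 (F v.1) := by
  simp [evol]

@[simp]
theorem evol_X_false (F : ℕ+ → DiffPoly) (j : ℕ+) (k : ℕ) :
    evol F (MvPolynomial.X (j, k, false)) = dxPow k (F j) := by
  simp [evol]

@[simp]
theorem evol_X_true (F : ℕ+ → DiffPoly) (j : ℕ+) (k : ℕ) :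
    evol F (MvPolynomial.X (j, k, true)) = bar (dxPow k (F j)) := by
  simp [evol]

@[simp]
theorem evol_u (F : ℕ+ → DiffPoly) (j : ℕ+) : evol F (u j) = F j := by
  simp [u]

theorem evol_dx (F : ℕ+ → DiffPoly) (p : DiffPoly) : evol F (dx p) = dx (evol F p) := by
  induction p using MvPolynomial.induction_on with
  | C a => simp
  | add p q hp hq => simp [hp, hq]
  | mul_X p v hp =>
    obtain ⟨j, k, b⟩ := v
    have hv : evol F (dx (MvPolynomial.X (j, k, b))) = dx (evol F (MvPolynomial.X (j, k, b))) := by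
      cases b <;> simp [dxPow_succ, dx_bar]
    simp only [Derivation.leibniz, map_add, smul_eq_mul, hp, hv]
    ring

theorem evol_dxPow (F : ℕ+ → DiffPoly) (k : ℕ) (p : DiffPoly) :
    evol F (dxPow k p) = dxPow k (evol F p) := by
  induction k with
  | zero => simp
  | succ k ih => rw [dxPow_succ, dxPow_succ, evol_dx, ih]

theorem evol_bar (F : ℕ+ → DiffPoly) (p : DiffPoly) : evol F (bar p) = bar (evol F p) := by
  induction p using MvPolynomial.induction_on with
  | C a => simp
  | add p q hp hq => simp [hp, hq]
  | mul_X p v hp =>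
    obtain ⟨j, k, b⟩ := v
    cases b <;> simp [hp]

/-- The time derivative only depends on the evolution of the amplitudes that occur. -/
theorem evol_congr {F G : ℕ+ → DiffPoly} {p : DiffPoly} {μ : ℕ}
    (hp : p ∈ MvPolynomial.supported ℂ {v : Jet | (v.1 : ℕ) ≤ μ})
    (h : ∀ j : ℕ+, (j : ℕ) ≤ μ → F j = G j) : evol F p = evol G p := by
  refine MvPolynomial.derivation_eqOn_supported (s := {v : Jet | (v.1 : ℕ) ≤ μ}) ?_ hp
  rintro v hv
  simp only [Set.mem_ofPred_eq] at hv
  simp [evol_X, h _ hv]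

/-- Derivations are compared on jet variables. On conjugate variables the flow carries `conj c`,
which is why `c` has to be real. -/
theorem evol_smul_dx {c : ℂ} (hc : conj c = c) (p : DiffPoly) :
    evol (fun j => c • dx (u j)) p = c • dx p := by
  have : evol (fun j => c • dx (u j)) = c • dx := by
    refine MvPolynomial.derivation_ext fun v => ?_
    obtain ⟨j, k, b⟩ := v
    cases b <;> simp [u, bar_smul, hc, add_comm]
  rw [this]; rfl

/-- `evol` commutes when it does so on the amplitudes. -/
theorem evol_comm {F G : ℕ+ → DiffPoly} (h : ∀ j, evol F (G j) = evol G (F j)) (p : DiffPoly) :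
    evol F (evol G p) = evol G (evol F p) := by
  induction p using MvPolynomial.induction_on with
  | C a => simp
  | add p q hp hq => simp [hp, hq]
  | mul_X p v hp =>
    obtain ⟨j, k, b⟩ := v
    have hv : evol F (evol G (MvPolynomial.X (j, k, b))) =
        evol G (evol F (MvPolynomial.X (j, k, b))) := by
      cases b <;> simp [evol_bar, evol_dxPow, h]
    simp only [Derivation.leibniz, map_add, smul_eq_mul, hp, hv]
    ring

theorem linFlow_smul (B : ℕ → ℝ) (s : ℕ) (a : ℂ) (p : DiffPoly) :
    linFlow B s (a • p) = a • linFlow B s p := by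
  simp only [linFlow, dxPow_smul]
  exact smul_comm _ _ _

theorem linFlow_add (B : ℕ → ℝ) (s : ℕ) (p q : DiffPoly) :
    linFlow B s (p + q) = linFlow B s p + linFlow B s q := by
  simp [linFlow]

theorem linFlow_sub (B : ℕ → ℝ) (s : ℕ) (p q : DiffPoly) :
    linFlow B s (p - q) = linFlow B s p - linFlow B s q := by
  simp [linFlow, smul_sub]

theorem evol_linFlow (F : ℕ+ → DiffPoly) (B : ℕ → ℝ) (s : ℕ) (p : DiffPoly) :
    evol F (linFlow B s p) = linFlow B s (evol F p) := by
  simp [linFlow, evol_dxPow]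

theorem linFlow_comm (B : ℕ → ℝ) (s r : ℕ) (p : DiffPoly) :
    linFlow B s (linFlow B r p) = linFlow B r (linFlow B s p) := by
  simp only [linFlow, dxPow_smul, dxPow_comm s r]
  exact smul_comm _ _ _

/-- The operator `M_s` when all amplitudes evolve linearly. -/
def linM (B : ℕ → ℝ) (s : ℕ) (p : DiffPoly) : DiffPoly :=
  evol (fun j => linFlow B s (u j)) p - linFlow B s p

/-- The linear flows commute with one another and with `∂`. This makes any forcing of the form `linM
B s p`, with `p` independent of `s`, satisfy the compatibility conditions. -/
theorem linM_comm (B : ℕ → ℝ) (s r : ℕ) (p : DiffPoly) :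
    linM B s (linM B r p) = linM B r (linM B s p) := by
  have h := evol_comm (F := fun j => linFlow B s (u j)) (G := fun j => linFlow B r (u j))
    (fun j => by simp only [evol_linFlow, evol_u, linFlow_comm]) p
  simp only [linM, map_sub, h, linFlow_sub, evol_linFlow, linFlow_comm B r s]
  ring

theorem linM_smul (B : ℕ → ℝ) (s : ℕ) (a : ℂ) (p : DiffPoly) :
    linM B s (a • p) = a • linM B s p := by
  simp [linM, linFlow_smul, smul_sub]

/-! ### Gradings -/

/-- The order in `ε` and the gauge of a jet variable. -/
def jetWeight (v : Jet) : ℕ × ℤ := (v.2.1 + (v.1 : ℕ), if v.2.2 then -1 else 1)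

theorem weight_jetWeight (m : Jet →₀ ℕ) :
    Finsupp.weight jetWeight m = (epsOrder m, gaugeWeight m) := by
  rw [Finsupp.weight_apply, epsOrder, gaugeWeight]
  ext
  · simp [Finsupp.sum, jetWeight, Prod.fst_sum]
  · simp only [Finsupp.sum, jetWeight, Prod.snd_sum, Prod.smul_mk]
    refine Finset.sum_congr rfl fun v _ => ?_
    cases v.2.2 <;> simp

/-- Differential polynomials of order `n` and gauge `θ`. -/
abbrev IsGraded (p : DiffPoly) (n : ℕ) (θ : ℤ) : Prop :=
  MvPolynomial.IsWeightedHomogeneous jetWeight p (n, θ)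

/-- Differential polynomials in the amplitudes `u_j`, `j ≤ μ`. -/
abbrev upTo (μ : ℕ) : Subalgebra ℂ DiffPoly :=
  MvPolynomial.supported ℂ {v : Jet | (v.1 : ℕ) ≤ μ}

theorem mem_upTo {p : DiffPoly} {μ : ℕ} :
    p ∈ upTo μ ↔ ∀ m ∈ p.support, ∀ v ∈ m.support, (v.1 : ℕ) ≤ μ := by
  rw [MvPolynomial.mem_supported]
  constructor
  · intro h m hm v hv
    exact h ((MvPolynomial.mem_vars_iff_mem_support v).mpr ⟨m, hm, hv⟩)
  · intro h v hv
    obtain ⟨m, hm, hv⟩ := (MvPolynomial.mem_vars_iff_mem_support v).mp hv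
    exact h m hm v hv

/-- Separates the bigrading, the index bound and the nonlinearity, so that each can be propagated by
its own argument. -/
theorem mem_P {ν μ : ℕ} {p : DiffPoly} :
    p ∈ P ν μ ↔ IsGraded p ν 1 ∧ p ∈ upTo μ ∧ ∀ m ∈ p.support, 2 ≤ m.degree := by
  rw [P, MvPolynomial.mem_restrictSupport_iff, mem_upTo]
  simp only [IsGraded, MvPolynomial.IsWeightedHomogeneous, weight_jetWeight, Prod.mk.injEq]
  constructor
  · intro h
    refine ⟨fun m hm => ?_, fun m hm => ?_, fun m hm => ?_⟩
    · obtain ⟨h1, h2, -, -⟩ := h (MvPolynomial.mem_support_iff.mpr hm)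
      exact ⟨h1, h2⟩
    · exact (h hm).2.2.2
    · exact (h hm).2.2.1
  · rintro ⟨h1, h2, h3⟩ m hm
    obtain ⟨h4, h5⟩ := h1 (MvPolynomial.mem_support_iff.mp hm)
    exact ⟨h4, h5, h3 m hm, h2 m hm⟩

theorem coeff_single_of_mem_P {ν μ : ℕ} {p : DiffPoly} (hp : p ∈ P ν μ) (v : Jet) :
    MvPolynomial.coeff (Finsupp.single v 1) p = 0 := by
  by_contra h
  have := (mem_P.mp hp).2.2 _ (MvPolynomial.mem_support_iff.mpr h)
  simp at this

/-- A derivation that shifts the weights of the variables by `s` shifts all weights by `s`. -/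
theorem isWeightedHomogeneous_derivation {σ N : Type*} [AddCommMonoid N] {w : σ → N}
    {D : Derivation ℂ (MvPolynomial σ ℂ) (MvPolynomial σ ℂ)} {s n : N} {p : MvPolynomial σ ℂ}
    (hD : ∀ v, (D (MvPolynomial.X v)).IsWeightedHomogeneous w (w v + s))
    (hp : p.IsWeightedHomogeneous w n) : (D p).IsWeightedHomogeneous w (n + s) := by
  have hDD : D = MvPolynomial.mkDerivation ℂ fun v => D (MvPolynomial.X v) :=
    MvPolynomial.derivation_ext fun v => by simp
  rw [p.as_sum, map_sum]
  refine MvPolynomial.IsWeightedHomogeneous.sum _ _ _ fun m hm => ?_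
  rw [hDD, MvPolynomial.mkDerivation_monomial]
  refine (MvPolynomial.weightedHomogeneousSubmodule ℂ w (n + s)).smul_mem _ ?_
  refine MvPolynomial.IsWeightedHomogeneous.sum _ _ _ fun v hv => ?_
  have hv1 : Finsupp.single v 1 ≤ m := by
    rw [Finsupp.single_le_iff]
    exact Nat.one_le_iff_ne_zero.mpr (Finsupp.mem_support_iff.mp hv)
  have hw : Finsupp.weight w (m - Finsupp.single v 1) + w v = n := by
    rw [← hp (MvPolynomial.mem_support_iff.mp hm)]
    conv_rhs => rw [← tsub_add_cancel_of_le hv1, map_add, Finsupp.weight_single, one_smul]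
  rw [← hw, add_assoc]
  exact (MvPolynomial.isWeightedHomogeneous_monomial w _ _ rfl).mul (hD v)

theorem derivation_mem_supported {σ : Type*} {s : Set σ}
    {D : Derivation ℂ (MvPolynomial σ ℂ) (MvPolynomial σ ℂ)}
    (hD : ∀ v ∈ s, D (MvPolynomial.X v) ∈ MvPolynomial.supported ℂ s) {p : MvPolynomial σ ℂ}
    (hp : p ∈ MvPolynomial.supported ℂ s) : D p ∈ MvPolynomial.supported ℂ s := by
  rw [MvPolynomial.supported_eq_adjoin_X] at hp
  induction hp using Algebra.adjoin_induction with
  | mem x hx =>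
    obtain ⟨v, hv, rfl⟩ := hx
    exact hD v hv
  | algebraMap r => simp
  | add x y _ _ hx hy => simpa using add_mem hx hy
  | mul x y hx' hy' hx hy =>
    rw [← MvPolynomial.supported_eq_adjoin_X] at hx' hy'
    rw [Derivation.leibniz, smul_eq_mul, smul_eq_mul]
    exact add_mem (mul_mem hx' hy) (mul_mem hy' hx)

theorem isGraded_X (v : Jet) :
    IsGraded (MvPolynomial.X v) (v.2.1 + (v.1 : ℕ)) (if v.2.2 then -1 else 1) :=
  MvPolynomial.isWeightedHomogeneous_X ℂ jetWeight v

theorem IsGraded.smul {p : DiffPoly} {n : ℕ} {θ : ℤ} (hp : IsGraded p n θ) (a : ℂ) :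
    IsGraded (a • p) n θ :=
  (MvPolynomial.weightedHomogeneousSubmodule ℂ jetWeight (n, θ)).smul_mem a hp

theorem IsGraded.dx {p : DiffPoly} {n : ℕ} {θ : ℤ} (hp : IsGraded p n θ) :
    IsGraded (dx p) (n + 1) θ := by
  have := isWeightedHomogeneous_derivation (D := MultiScale.dx) (w := jetWeight)
    (s := ((1, 0) : ℕ × ℤ)) (fun v => by
      rw [dx_X]
      convert! MvPolynomial.isWeightedHomogeneous_X ℂ jetWeight _ using 1
      ext <;> simp [jetWeight]; ring) hp
  simpa using this

theorem dx_mem_upTo {p : DiffPoly} {μ : ℕ} (hp : p ∈ upTo μ) : dx p ∈ upTo μ :=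
  derivation_mem_supported (fun v hv => by
    rw [dx_X]; exact MvPolynomial.X_mem_supported.mpr hv) hp

theorem IsGraded.dxPow {p : DiffPoly} {n : ℕ} {θ : ℤ} (hp : IsGraded p n θ) (k : ℕ) :
    IsGraded (dxPow k p) (n + k) θ := by
  induction k with
  | zero => simpa
  | succ k ih => rw [dxPow_succ, ← add_assoc]; exact ih.dx

theorem dxPow_mem_upTo {p : DiffPoly} {μ : ℕ} (hp : p ∈ upTo μ) (k : ℕ) :
    dxPow k p ∈ upTo μ := by
  induction k with
  | zero => simpa
  | succ k ih => rw [dxPow_succ]; exact dx_mem_upTo ih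

theorem isHomogeneous_dxPow {p : DiffPoly} {d : ℕ} (hp : p.IsHomogeneous d) (k : ℕ) :
    (dxPow k p).IsHomogeneous d := by
  induction k with
  | zero => simpa
  | succ k ih =>
    rw [dxPow_succ]
    exact isWeightedHomogeneous_derivation (D := MultiScale.dx) (s := 0) (fun v => by
      rw [dx_X]; exact MvPolynomial.isHomogeneous_X ℂ _) ih

theorem linM_mem_upTo (B : ℕ → ℝ) (s : ℕ) {p : DiffPoly} {μ : ℕ} (hp : p ∈ upTo μ) :
    linM B s p ∈ upTo μ := by
  refine sub_mem (derivation_mem_supported (fun v hv => ?_) hp)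
    (Subalgebra.smul_mem _ (dxPow_mem_upTo hp s) _)
  obtain ⟨j, k, b⟩ := v
  cases b <;>
    simpa [linFlow, u, bar_smul] using
      Subalgebra.smul_mem _ (MvPolynomial.X_mem_supported.mpr (by exact hv)) _

theorem IsGraded.linM (B : ℕ → ℝ) (s : ℕ) {p : DiffPoly} {n : ℕ} {θ : ℤ} (hp : IsGraded p n θ) :
    IsGraded (linM B s p) (n + s) θ := by
  refine MvPolynomial.IsWeightedHomogeneous.sub ?_ ((hp.dxPow s).smul _)
  have := isWeightedHomogeneous_derivation (D := evol fun j => linFlow B s (u j))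
    (w := jetWeight) (s := ((s, 0) : ℕ × ℤ)) (fun v => by
      obtain ⟨j, k, b⟩ := v
      have h : jetWeight (j, k, b) + (s, 0) = jetWeight (j, s + k, b) := by
        ext <;> simp [jetWeight]; ring
      rw [h]
      cases b <;>
        simpa [linFlow, u, bar_smul] using
          (MvPolynomial.weightedHomogeneousSubmodule ℂ jetWeight _).smul_mem _
            (MvPolynomial.isWeightedHomogeneous_X ℂ jetWeight _)) hp
  simpa using this

theorem isHomogeneous_linM (B : ℕ → ℝ) (s : ℕ) {p : DiffPoly} {d : ℕ} (hp : p.IsHomogeneous d) :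
    (linM B s p).IsHomogeneous d := by
  refine MvPolynomial.IsHomogeneous.sub ?_
    ((MvPolynomial.homogeneousSubmodule Jet ℂ d).smul_mem _ (isHomogeneous_dxPow hp s))
  refine isWeightedHomogeneous_derivation (s := 0) (fun v => ?_) hp
  change MvPolynomial.IsHomogeneous _ 1
  obtain ⟨j, k, b⟩ := v
  cases b <;>
    simpa [linFlow, u, bar_smul] using
      (MvPolynomial.homogeneousSubmodule Jet ℂ 1).smul_mem _ (MvPolynomial.isHomogeneous_X ℂ _)

/-- The resonant cubic term `|u_1|² u_1`. -/
def cubic : DiffPoly := u 1 * bar (u 1) * u 1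

theorem isGraded_cubic : IsGraded cubic 3 1 := by
  have := ((isGraded_X (1, 0, false)).mul (isGraded_X (1, 0, true))).mul
    (isGraded_X (1, 0, false))
  simpa [cubic, u] using this

theorem cubic_mem_upTo {μ : ℕ} (hμ : 1 ≤ μ) : cubic ∈ upTo μ := by
  have hX : ∀ b, (MvPolynomial.X ((1, 0, b) : Jet) : DiffPoly) ∈ upTo μ := fun b =>
    MvPolynomial.X_mem_supported.mpr (by simpa using hμ)
  simpa [cubic, u] using mul_mem (mul_mem (hX false) (hX true)) (hX false)

/-- Being a linear flow minus a power of `∂`, `linM` preserves degree and gauge and raises the order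
by `s`; the degree stays 3. -/
theorem linM_cubic_mem_P (B : ℕ → ℝ) (s : ℕ) {μ : ℕ} (hμ : 1 ≤ μ) :
    linM B s cubic ∈ P (s + 3) μ := by
  have h2 : cubic.IsHomogeneous 3 := by
    have := ((MvPolynomial.isHomogeneous_X ℂ ((1, 0, false) : Jet)).mul
      (MvPolynomial.isHomogeneous_X ℂ ((1, 0, true) : Jet))).mul
      (MvPolynomial.isHomogeneous_X ℂ ((1, 0, false) : Jet))
    simpa [cubic, u] using this
  rw [mem_P, add_comm]
  refine ⟨isGraded_cubic.linM B s, linM_mem_upTo B s (cubic_mem_upTo hμ), fun m hm => ?_⟩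
  have := isHomogeneous_linM B s h2 (MvPolynomial.mem_support_iff.mp hm)
  rw [Pi.one_def, ← Finsupp.degree_eq_weight_one] at this
  omega

/-! ### The kernel of the linear Schrödinger operator -/

/-- The commutator of `∂/∂(∂^{m+1} u_j)` with `∂` is `∂/∂(∂^m u_j)`. It lets information about high
jets descend to lower ones. -/
theorem pderiv_dx (j : ℕ+) (m : ℕ) (b : Bool) (p : DiffPoly) :
    MvPolynomial.pderiv (j, m + 1, b) (dx p) =
      dx (MvPolynomial.pderiv (j, m + 1, b) p) + MvPolynomial.pderiv (j, m, b) p := by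
  induction p using MvPolynomial.induction_on with
  | C a => simp
  | add p q hp hq => simp only [map_add, hp, hq]; ring
  | mul_X p v hp =>
    obtain ⟨j', m', b'⟩ := v
    have h1 : (MvPolynomial.pderiv (j, m + 1, b))
        (MvPolynomial.X (j', m' + 1, b') : DiffPoly) =
        MvPolynomial.pderiv (j, m, b) (MvPolynomial.X (j', m', b')) := by
      classical
      simp only [MvPolynomial.pderiv_X, Pi.single_apply, Prod.mk.injEq, Nat.succ_inj]
    have h2 : dx (MvPolynomial.pderiv (j, m + 1, b) (MvPolynomial.X (j', m', b') : DiffPoly))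
        = 0 := by
      classical
      rw [MvPolynomial.pderiv_X, Pi.single_apply]
      split_ifs <;> simp
    simp only [Derivation.leibniz, map_add, smul_eq_mul, hp, dx_X, h1, h2]
    ring

theorem notMem_support_of_pderiv_eq_zero {σ : Type*} {p : MvPolynomial σ ℂ} {v : σ}
    (h : MvPolynomial.pderiv v p = 0) {m : σ →₀ ℕ} (hm : m ∈ p.support) : v ∉ m.support := by
  intro hv
  have h1 := congrArg (MvPolynomial.coeff (m - Finsupp.single v 1)) h
  have hle : Finsupp.single v 1 ≤ m := by
    rw [Finsupp.single_le_iff]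
    exact Nat.one_le_iff_ne_zero.mpr (Finsupp.mem_support_iff.mp hv)
  rw [MvPolynomial.coeff_pderiv, tsub_add_cancel_of_le hle] at h1
  simp only [MvPolynomial.coeff_zero, mul_eq_zero] at h1
  rcases h1 with h1 | h1
  · exact MvPolynomial.mem_support_iff.mp hm h1
  · exact Nat.cast_add_one_ne_zero _ h1

/-- To show that a polynomial does not involve the jets of an amplitude, one may assume this for
the two next jets. -/
theorem pderiv_eq_zero_of_step {j : ℕ+} {b : Bool} {p : DiffPoly}
    -- Only finitely many jets occur in a polynomial, so the claim holds for large `m` and this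
    -- hypothesis carries it down to every `m`.
    (step : ∀ m, MvPolynomial.pderiv (j, m + 1, b) p = 0 →
      MvPolynomial.pderiv (j, m + 2, b) p = 0 → MvPolynomial.pderiv (j, m, b) p = 0) (m : ℕ) :
    MvPolynomial.pderiv (j, m, b) p = 0 := by
  obtain ⟨N, hN⟩ : ∃ N : ℕ, ∀ v ∈ p.vars, v.2.1 < N := by
    refine ⟨p.vars.sup (fun v => v.2.1) + 1, fun v hv => Nat.lt_succ_of_le ?_⟩
    exact Finset.le_sup (f := fun v : Jet => v.2.1) hv
  have hbig : ∀ m, N ≤ m → MvPolynomial.pderiv (j, m, b) p = 0 := fun m hm =>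
    MvPolynomial.pderiv_eq_zero_of_notMem_vars fun hv => absurd (hN _ hv) (by simpa using hm)
  have hall : ∀ k m, N ≤ m + k → MvPolynomial.pderiv (j, m, b) p = 0 := by
    intro k
    induction k with
    | zero => exact hbig
    | succ k ih => exact fun m hm => step m (ih _ (by omega)) (ih _ (by omega))
  exact hall N m (by omega)

/-- The kernel of `∂` consists of the constants. -/
theorem eq_zero_of_dx_eq_zero {p : DiffPoly} (hp : dx p = 0)
    (h0 : MvPolynomial.constantCoeff p = 0) : p = 0 := by
  -- When `∂p = 0`, the commutator relation turns vanishing of one jet derivative into vanishing of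
  -- the one below it.
  have h1 : ∀ v : Jet, MvPolynomial.pderiv v p = 0 := fun v =>
    pderiv_eq_zero_of_step (fun m h1 _ => by
      have h2 := pderiv_dx v.1 m v.2.2 p
      rw [hp, h1, map_zero, map_zero, zero_add] at h2
      exact h2.symm) v.2.1
  by_contra hne
  obtain ⟨m, hm⟩ := MvPolynomial.support_nonempty.mpr hne
  have hm0 : m = 0 := by
    rw [← Finsupp.support_eq_empty, Finset.eq_empty_iff_forall_notMem]
    exact fun v => notMem_support_of_pderiv_eq_zero (h1 v) hm
  rw [hm0] at hm
  exact MvPolynomial.mem_support_iff.mp hm h0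

/-- The flow moves a conjugate jet up by `s` with coefficient `conj l`, whereas `l ∂^s` moves it
with coefficient `l`. For imaginary `l` the two signs differ, which drives the kernel computation
below. -/
theorem pderiv_evol_linear (l : ℂ) (s : ℕ) (j : ℕ+) (m : ℕ) (p : DiffPoly) :
    MvPolynomial.pderiv (j, m + s, true) (evol (fun j => l • dxPow s (u j)) p) =
      evol (fun j => l • dxPow s (u j)) (MvPolynomial.pderiv (j, m + s, true) p) +
        conj l • MvPolynomial.pderiv (j, m, true) p := by
  induction p using MvPolynomial.induction_on with
  | C a => simp
  | add p q hp hq => simp only [map_add, hp, hq, smul_add]; ring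
  | mul_X p v hp =>
    obtain ⟨j', m', b'⟩ := v
    have h1 : (MvPolynomial.pderiv (j, m + s, true))
        (evol (fun j => l • dxPow s (u j)) (MvPolynomial.X (j', m', b'))) =
        conj l • MvPolynomial.pderiv (j, m, true) (MvPolynomial.X (j', m', b') : DiffPoly) := by
      classical
      cases b' <;>
      simp [MvPolynomial.pderiv_X, Pi.single_apply, u, bar_smul, add_comm s]
    have h2 : evol (fun j => l • dxPow s (u j))
        (MvPolynomial.pderiv (j, m + s, true) (MvPolynomial.X (j', m', b') : DiffPoly))
        = 0 := by
      classical
      rw [MvPolynomial.pderiv_X, Pi.single_apply]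
      split_ifs <;> simp
    simp only [Derivation.leibniz, map_add, smul_eq_mul, hp, h1, h2, smul_add, mul_smul_comm]
    ring_nf
    simp only [mul_smul_comm]
    ring

/-- No nonlinear differential polynomial of gauge `1` is annihilated by the linear Schrödinger
operator. -/
theorem eq_zero_of_schroedinger {l : ℂ} (hl : l ≠ 0) (hl' : conj l = -l) {ν μ : ℕ}
    {p : DiffPoly} (hp : p ∈ P ν μ)
    (h : evol (fun j => l • dxPow 2 (u j)) p = l • dxPow 2 p) : p = 0 := by
  -- Differentiating the equation by the conjugate jet of order `m + 2` leaves `conj l = -l` times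
  -- the jet derivative of order `m` on one side and `l` times it on the other.
  have step : ∀ (j : ℕ+) (m : ℕ), MvPolynomial.pderiv (j, m + 1, true) p = 0 →
      MvPolynomial.pderiv (j, m + 2, true) p = 0 → MvPolynomial.pderiv (j, m, true) p = 0 := by
    intro j m h1 h2
    have h3 := congrArg (MvPolynomial.pderiv (j, m + 2, true)) h
    have h4 : dxPow 2 p = dx (dx p) := rfl
    rw [pderiv_evol_linear, h2, map_zero, hl', Derivation.map_smul, h4, pderiv_dx, pderiv_dx,
      pderiv_dx, h1, h2] at h3
    simp only [map_zero, zero_add] at h3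
    have h5 : (2 * l) • MvPolynomial.pderiv (j, m, true) p = 0 := by
      rw [neg_smul] at h3
      rw [two_mul, add_smul]
      nth_rw 1 [← h3]
      simp
    exact (smul_eq_zero.mp h5).resolve_left (by simp [hl])
  have hbar := fun (j : ℕ+) (m : ℕ) => pderiv_eq_zero_of_step (step j) m
  obtain ⟨hg, -, hd⟩ := mem_P.mp hp
  by_contra hne
  obtain ⟨m, hm⟩ := MvPolynomial.support_nonempty.mpr hne
  have hm0 : ∀ v ∈ m.support, v.2.2 = false := by
    rintro ⟨j, k, b⟩ hv
    by_contra hb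
    simp only [Bool.not_eq_false] at hb
    subst hb
    exact notMem_support_of_pderiv_eq_zero (hbar j k) hm hv
  have h1 := hg (MvPolynomial.mem_support_iff.mp hm)
  rw [weight_jetWeight] at h1
  -- Without conjugate variables the gauge counts factors, so gauge 1 means degree 1, contrary to
  -- nonlinearity.
  have h2 : gaugeWeight m = (m.degree : ℤ) := by
    rw [gaugeWeight, Finsupp.degree_apply, Finsupp.sum]
    push_cast
    exact Finset.sum_congr rfl fun v hv => by simp [hm0 v hv]
  have h3 := hd m hm
  have h4 : gaugeWeight m = 1 := congrArg Prod.snd h1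
  omega

/-! ### Formal series of harmonics and graded operators -/

/-- Formal series in `ε` of Laurent polynomials in the harmonic variable. -/
abbrev Series : Type := DiffPoly[T;T⁻¹]⟦X⟧

/-- The coefficient of `ε^n E^θ`. -/
def cf (f : Series) (n : ℕ) (θ : ℤ) : DiffPoly := (PowerSeries.coeff n f).coeff θ

theorem cf_ext {f g : Series} (h : ∀ n θ, cf f n θ = cf g n θ) : f = g := by
  ext n : 1
  exact LaurentPolynomial.ext (h n)

@[simp] theorem cf_add (f g : Series) (n : ℕ) (θ : ℤ) : cf (f + g) n θ = cf f n θ + cf g n θ := by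
  simp [cf]

@[simp] theorem cf_sub (f g : Series) (n : ℕ) (θ : ℤ) : cf (f - g) n θ = cf f n θ - cf g n θ := by
  simp [cf]

@[simp] theorem cf_zero (n : ℕ) (θ : ℤ) : cf 0 n θ = 0 := by
  simp [cf]

@[simp] theorem cf_smul (a : ℂ) (f : Series) (n : ℕ) (θ : ℤ) : cf (a • f) n θ = a • cf f n θ := by
  simp [cf]

/-- The series `p E^θ`. -/
def mono (p : DiffPoly) (θ : ℤ) : Series :=
  PowerSeries.C (LaurentPolynomial.C p * LaurentPolynomial.T θ)

theorem mono_mul (p q : DiffPoly) (a b : ℤ) : mono p a * mono q b = mono (p * q) (a + b) := by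
  rw [mono, mono, mono, ← map_mul, LaurentPolynomial.T_add, map_mul LaurentPolynomial.C,
    mul_mul_mul_comm]

theorem one_eq_mono : (1 : Series) = mono 1 0 := by
  simp [mono]

theorem cf_mono (p : DiffPoly) (a : ℤ) (n : ℕ) (θ : ℤ) :
    cf (mono p a) n θ = if n = 0 ∧ θ = a then p else 0 := by
  rw [cf, mono, PowerSeries.coeff_C]
  by_cases hn : n = 0
  · rw [if_pos hn, ← LaurentPolynomial.single_eq_C_mul_T, AddMonoidAlgebra.coeff_single,
      Finsupp.single_apply]
    simp [hn, eq_comm]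
  · rw [if_neg hn, if_neg (fun h => hn h.1)]
    rfl

theorem cf_one (n : ℕ) (θ : ℤ) : cf 1 n θ = if n = 0 ∧ θ = 0 then 1 else 0 := by
  rw [one_eq_mono, cf_mono]

/-- Additive maps commuting with multiplication by `ε` are determined on monomials. -/
theorem eq_zero_of_mono {L : Series → Series} (hadd : ∀ f g, L (f + g) = L f + L g)
    (hX : ∀ f, L (PowerSeries.X * f) = PowerSeries.X * L f) (hm : ∀ p θ, L (mono p θ) = 0)
    (f : Series) : L f = 0 := by
  have hC : ∀ x, L (PowerSeries.C x) = 0 := by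
    intro x
    induction x using LaurentPolynomial.induction_on' with
    | add p q hp hq => rw [map_add, hadd, hp, hq, add_zero]
    | C_mul_T n a => exact hm a n
  -- Up to its constant term, `f` is `ε` times another series, so each step lowers the order by one.
  -- No continuity of `L` is needed.
  have : ∀ n f, PowerSeries.coeff n (L f) = 0 := by
    intro n
    induction n with
    | zero =>
      intro f
      rw [PowerSeries.eq_X_mul_shift_add_const f, hadd, hX, hC, add_zero,
        PowerSeries.coeff_zero_X_mul]
    | succ n ih =>
      intro f
      rw [PowerSeries.eq_X_mul_shift_add_const f, hadd, hX, hC, add_zero,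
        PowerSeries.coeff_succ_X_mul, ih]
  ext n : 1
  rw [this, map_zero]

/-- Biadditive maps commuting with multiplication by `ε` are determined on monomials. -/
theorem eq_zero_of_mono₂ {L : Series → Series → Series}
    (hadd₁ : ∀ f f' g, L (f + f') g = L f g + L f' g)
    (hadd₂ : ∀ f g g', L f (g + g') = L f g + L f g')
    (hX₁ : ∀ f g, L (PowerSeries.X * f) g = PowerSeries.X * L f g)
    (hX₂ : ∀ f g, L f (PowerSeries.X * g) = PowerSeries.X * L f g)
    (hm : ∀ p θ p' θ', L (mono p θ) (mono p' θ') = 0) (f g : Series) : L f g = 0 :=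
  eq_zero_of_mono (L := fun f => L f g) (fun f f' => hadd₁ f f' g) (fun f => hX₁ f g)
    (fun p θ => eq_zero_of_mono (hadd₂ _) (hX₂ _) (hm p θ) g) f

/-- The operator on Laurent polynomials acting on the `θ`-th harmonic by `g θ`. -/
def harmonicMap (g : ℤ → DiffPoly →ₗ[ℂ] DiffPoly) : DiffPoly[T;T⁻¹] →+ DiffPoly[T;T⁻¹] where
  toFun f := .ofCoeff (Finsupp.onFinset f.coeff.support (fun θ => g θ (f.coeff θ)) fun θ h => by
    rw [Finsupp.mem_support_iff]
    rintro h'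
    simp [h'] at h)
  map_zero' := by ext; simp
  map_add' f g := by ext; simp

theorem harmonicMap_coeff (g : ℤ → DiffPoly →ₗ[ℂ] DiffPoly) (f : DiffPoly[T;T⁻¹]) (θ : ℤ) :
    (harmonicMap g f).coeff θ = g θ (f.coeff θ) := rfl

theorem harmonicMap_mono (g : ℤ → DiffPoly →ₗ[ℂ] DiffPoly) (p : DiffPoly) (θ : ℤ) :
    harmonicMap g (LaurentPolynomial.C p * LaurentPolynomial.T θ) =
      LaurentPolynomial.C (g θ p) * LaurentPolynomial.T θ := by
  refine LaurentPolynomial.ext fun a => ?_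
  rw [harmonicMap_coeff, ← LaurentPolynomial.single_eq_C_mul_T,
    ← LaurentPolynomial.single_eq_C_mul_T, AddMonoidAlgebra.coeff_single,
    AddMonoidAlgebra.coeff_single, Finsupp.single_apply, Finsupp.single_apply]
  split_ifs with h
  · rw [h]
  · simp

/-- The operator on formal series whose part of order `ε^k` acts on the `θ`-th harmonic by
`φ k θ`. -/
def seriesOp (φ : ℕ → ℤ → DiffPoly →ₗ[ℂ] DiffPoly) : Series →+ Series where
  toFun f := PowerSeries.mk fun n => ∑ kl ∈ Finset.HasAntidiagonal.antidiagonal n,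
    harmonicMap (φ kl.1) (PowerSeries.coeff kl.2 f)
  map_zero' := by ext; simp
  map_add' f g := by
    ext n : 1
    simp [Finset.sum_add_distrib]

variable (φ ψ : ℕ → ℤ → DiffPoly →ₗ[ℂ] DiffPoly)

theorem coeff_seriesOp (f : Series) (n : ℕ) :
    PowerSeries.coeff n (seriesOp φ f) = ∑ kl ∈ Finset.HasAntidiagonal.antidiagonal n,
      harmonicMap (φ kl.1) (PowerSeries.coeff kl.2 f) := by
  simp [seriesOp]

theorem cf_seriesOp (f : Series) (n : ℕ) (θ : ℤ) :
    cf (seriesOp φ f) n θ = ∑ kl ∈ Finset.HasAntidiagonal.antidiagonal n,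
      φ kl.1 θ (cf f kl.2 θ) := by
  rw [cf, coeff_seriesOp, AddMonoidAlgebra.coeff_sum, Finset.sum_apply']
  rfl

theorem seriesOp_X_mul (f : Series) :
    seriesOp φ (PowerSeries.X * f) = PowerSeries.X * seriesOp φ f := by
  ext n : 1
  rw [coeff_seriesOp]
  cases n with
  | zero => simp
  | succ n =>
    rw [Finset.Nat.sum_antidiagonal_succ', PowerSeries.coeff_succ_X_mul, coeff_seriesOp]
    simp [PowerSeries.coeff_succ_X_mul]

theorem seriesOp_X_pow_mul (m : ℕ) (f : Series) :
    seriesOp φ (PowerSeries.X ^ m * f) = PowerSeries.X ^ m * seriesOp φ f := by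
  induction m with
  | zero => simp
  | succ m ih => rw [pow_succ', mul_assoc, seriesOp_X_mul, ih, mul_assoc]

theorem coeff_seriesOp_mono (p : DiffPoly) (θ : ℤ) (n : ℕ) :
    PowerSeries.coeff n (seriesOp φ (mono p θ)) =
      LaurentPolynomial.C (φ n θ p) * LaurentPolynomial.T θ := by
  rw [coeff_seriesOp, Finset.sum_eq_single (n, 0)]
  · rw [mono, PowerSeries.coeff_zero_C, harmonicMap_mono]
  · rintro ⟨k, l⟩ h h'
    have : l ≠ 0 := by
      rintro rfl
      exact h' (by simpa using h)
    rw [mono, PowerSeries.coeff_C, if_neg this, map_zero]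
  · simp

theorem seriesOp_smul (a : ℂ) (f : Series) : seriesOp φ (a • f) = a • seriesOp φ f := by
  refine cf_ext fun n θ => ?_
  simp [cf_seriesOp, Finset.smul_sum]

variable {φ ψ}

theorem coeff_seriesOp_seriesOp_mono (p : DiffPoly) (θ : ℤ) (n : ℕ) :
    PowerSeries.coeff n (seriesOp φ (seriesOp ψ (mono p θ))) =
      LaurentPolynomial.C (∑ kl ∈ Finset.HasAntidiagonal.antidiagonal n,
        φ kl.1 θ (ψ kl.2 θ p)) * LaurentPolynomial.T θ := by
  rw [coeff_seriesOp, map_sum, Finset.sum_mul]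
  exact Finset.sum_congr rfl fun kl _ => by rw [coeff_seriesOp_mono, harmonicMap_mono]

theorem seriesOp_comm (h : ∀ k l θ p, φ k θ (ψ l θ p) = ψ l θ (φ k θ p)) (f : Series) :
    seriesOp φ (seriesOp ψ f) = seriesOp ψ (seriesOp φ f) := by
  refine sub_eq_zero.mp (eq_zero_of_mono
    (L := fun f => seriesOp φ (seriesOp ψ f) - seriesOp ψ (seriesOp φ f)) ?_ ?_ ?_ f)
  · intro f g
    simp only [map_add]; ring
  · intro f
    simp only [seriesOp_X_mul]; ring
  · intro p θ
    rw [sub_eq_zero]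
    ext n : 1
    rw [coeff_seriesOp_seriesOp_mono, coeff_seriesOp_seriesOp_mono,
      ← Finset.Nat.sum_antidiagonal_swap]
    simp only [Prod.fst_swap, Prod.snd_swap, h]

/-! ### Shifts -/

/-- The part of order `ε^k` of the shift by `σ`. -/
def shiftPart (x : ℝ) (σ : ℤ) (k : ℕ) (θ : ℤ) : DiffPoly →ₗ[ℂ] DiffPoly :=
  (((σ : ℂ) ^ k / (k.factorial : ℂ)) * Complex.exp (Complex.I * σ * θ * x)) • dxPowₗ k

theorem shiftPart_apply (x : ℝ) (σ : ℤ) (k : ℕ) (θ : ℤ) (p : DiffPoly) :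
    shiftPart x σ k θ p =
      (((σ : ℂ) ^ k / (k.factorial : ℂ)) * Complex.exp (Complex.I * σ * θ * x)) • dxPow k p := by
  simp [shiftPart, dxPowₗ_apply]

/-- On monomials, the Leibniz rule divided by `k!` is the Cauchy product for `exp (σ ε ∂)`, and the
phases of the two harmonics multiply. -/
theorem seriesOp_shiftPart_mul (x : ℝ) (σ : ℤ) (f g : Series) :
    seriesOp (shiftPart x σ) (f * g) =
      seriesOp (shiftPart x σ) f * seriesOp (shiftPart x σ) g := by
  refine sub_eq_zero.mp (eq_zero_of_mono₂ (L := fun f g => seriesOp (shiftPart x σ) (f * g) -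
      seriesOp (shiftPart x σ) f * seriesOp (shiftPart x σ) g) ?_ ?_ ?_ ?_ ?_ f g)
  · intro f f' g
    simp only [map_add, add_mul]; ring
  · intro f g g'
    simp only [map_add, mul_add]; ring
  · intro f g
    simp only [mul_assoc, seriesOp_X_mul]; ring
  · intro f g
    simp only [mul_left_comm f, seriesOp_X_mul]; ring
  · intro p θ p' θ'
    rw [sub_eq_zero, mono_mul]
    ext n : 1
    rw [coeff_seriesOp_mono, PowerSeries.coeff_mul, shiftPart_apply, dxPow_mul, Finset.smul_sum,
      map_sum, Finset.sum_mul, LaurentPolynomial.T_add]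
    refine Finset.sum_congr rfl fun ij hij => ?_
    obtain ⟨i, j⟩ := ij
    obtain rfl : i + j = n := by simpa using hij
    rw [coeff_seriesOp_mono, coeff_seriesOp_mono, mul_mul_mul_comm, ← map_mul]
    congr 2
    rw [shiftPart_apply, shiftPart_apply, smul_mul_smul_comm, ← Nat.cast_smul_eq_nsmul ℂ, smul_smul]
    congr 1
    have h2 : Complex.I * σ * ((θ + θ' : ℤ) : ℂ) * x =
        Complex.I * σ * θ * x + Complex.I * σ * θ' * x := by push_cast; ring
    have h3 : ((i + j).factorial : ℂ) ≠ 0 := by exact_mod_cast Nat.factorial_ne_zero _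
    rw [Nat.cast_add_choose ℂ, h2, Complex.exp_add, pow_add]
    field_simp

theorem seriesOp_one {φ : ℕ → ℤ → DiffPoly →ₗ[ℂ] DiffPoly} (h0 : φ 0 0 1 = 1)
    (h : ∀ k, k ≠ 0 → φ k 0 1 = 0) : seriesOp φ 1 = 1 := by
  rw [one_eq_mono]
  ext n : 1
  rw [coeff_seriesOp_mono, ← one_eq_mono, PowerSeries.coeff_one]
  split_ifs with hn
  · subst hn
    simp [h0]
  · simp [h n hn]

theorem dxPow_one_eq_zero {k : ℕ} (hk : k ≠ 0) : dxPow k 1 = 0 := by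
  obtain ⟨k, rfl⟩ := Nat.exists_eq_succ_of_ne_zero hk
  rw [Nat.succ_eq_add_one, dxPow_add]
  simp

/-- The shift of the lattice variable by `σ`. -/
def shift (x : ℝ) (σ : ℤ) : Series →+* Series where
  __ := seriesOp (shiftPart x σ)
  map_one' := seriesOp_one (by simp [shiftPart_apply]) fun k hk => by
    simp [shiftPart_apply, dxPow_one_eq_zero hk]
  map_mul' := seriesOp_shiftPart_mul x σ

theorem shift_apply (x : ℝ) (σ : ℤ) (f : Series) :
    shift x σ f = seriesOp (shiftPart x σ) f := rfl

theorem shift_smul (x : ℝ) (σ : ℤ) (a : ℂ) (f : Series) : shift x σ (a • f) = a • shift x σ f :=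
  seriesOp_smul _ _ _

theorem shift_X_pow_mul (x : ℝ) (σ : ℤ) (m : ℕ) (f : Series) :
    shift x σ (PowerSeries.X ^ m * f) = PowerSeries.X ^ m * shift x σ f :=
  seriesOp_X_pow_mul _ _ _

theorem cf_shift (x : ℝ) (σ : ℤ) (f : Series) (n : ℕ) (θ : ℤ) :
    cf (shift x σ f) n θ = ∑ k ∈ Finset.range (n + 1),
      (((σ : ℂ) ^ k / (k.factorial : ℂ)) * Complex.exp (Complex.I * σ * θ * x)) •
        dxPow k (cf f (n - k) θ) := by
  rw [shift_apply, cf_seriesOp, Finset.Nat.sum_antidiagonal_eq_sum_range_succ_mk]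
  simp only [shiftPart_apply]

theorem shift_zero (x : ℝ) (f : Series) : shift x 0 f = f := by
  refine cf_ext fun n θ => ?_
  rw [cf_shift, Finset.sum_eq_single 0]
  · simp
  · intro k _ hk
    simp [hk]
  · simp

theorem shift_shift (x : ℝ) (σ τ : ℤ) (f : Series) :
    shift x σ (shift x τ f) = shift x (σ + τ) f := by
  refine sub_eq_zero.mp (eq_zero_of_mono
    (L := fun f => shift x σ (shift x τ f) - shift x (σ + τ) f) ?_ ?_ ?_ f)
  · intro f g
    simp only [map_add]; ring
  · intro f
    simp only [shift_apply, seriesOp_X_mul]; ring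
  · intro p θ
    rw [sub_eq_zero]
    ext n : 1
    rw [shift_apply, shift_apply, shift_apply, coeff_seriesOp_seriesOp_mono, coeff_seriesOp_mono]
    congr 2
    rw [shiftPart_apply]
    have h2 : Complex.I * ((σ + τ : ℤ) : ℂ) * θ * x =
        Complex.I * σ * θ * x + Complex.I * τ * θ * x := by push_cast; ring
    rw [h2, Complex.exp_add, Int.cast_add, (Commute.all _ _).add_pow', Finset.sum_div,
      Finset.sum_mul, Finset.sum_smul]
    refine Finset.sum_congr rfl fun ij hij => ?_
    obtain ⟨i, j⟩ := ij
    obtain rfl : i + j = n := by simpa using hij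
    rw [shiftPart_apply, shiftPart_apply, dxPow_smul, smul_smul, ← dxPow_add, nsmul_eq_mul]
    congr 1
    have h3 : ((i + j).factorial : ℂ) ≠ 0 := by exact_mod_cast Nat.factorial_ne_zero _
    rw [Nat.cast_add_choose ℂ]
    field_simp

/-! ### The time derivative -/

/-- The part of order `ε^s` of the time derivative. -/
def timePart (ω : ℝ) (F : ℕ → ℕ+ → DiffPoly) (s : ℕ) (θ : ℤ) : DiffPoly →ₗ[ℂ] DiffPoly :=
  if s = 0 then (-(Complex.I * θ * ω)) • LinearMap.id else (evol (F s) : DiffPoly →ₗ[ℂ] DiffPoly)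

theorem timePart_zero (ω : ℝ) (F : ℕ → ℕ+ → DiffPoly) (θ : ℤ) (p : DiffPoly) :
    timePart ω F 0 θ p = (-(Complex.I * θ * ω)) • p := by
  simp [timePart]

theorem timePart_of_ne_zero (ω : ℝ) (F : ℕ → ℕ+ → DiffPoly) {s : ℕ} (hs : s ≠ 0) (θ : ℤ)
    (p : DiffPoly) : timePart ω F s θ p = evol (F s) p := by
  simp [timePart, hs]

/-- The total time derivative of formal series. -/
def timeD (ω : ℝ) (F : ℕ → ℕ+ → DiffPoly) : Series →+ Series := seriesOp (timePart ω F)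

theorem cf_timeD (ω : ℝ) (F : ℕ → ℕ+ → DiffPoly) (f : Series) (n : ℕ) (θ : ℤ) :
    cf (timeD ω F f) n θ = (-(Complex.I * θ * ω)) • cf f n θ +
      ∑ s ∈ Finset.Icc 1 n, evol (F s) (cf f (n - s) θ) := by
  rw [timeD, cf_seriesOp, Finset.Nat.sum_antidiagonal_eq_sum_range_succ_mk, Finset.range_eq_Ico,
    Finset.sum_eq_sum_Ico_succ_bot (Nat.succ_pos n), timePart_zero]
  congr 1
  refine Finset.sum_congr (by ext; simp) fun s hs => ?_
  exact timePart_of_ne_zero _ _ (by have := (Finset.mem_Icc.mp hs).1; omega) _ _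

/-- At `s = 0` the operator multiplies the harmonic `θ` by a number additive in `θ`; at `s > 0` it
is a derivation on the coefficients. Both obey the Leibniz rule. -/
theorem timePart_mul (ω : ℝ) (F : ℕ → ℕ+ → DiffPoly) (s : ℕ) (θ θ' : ℤ) (p q : DiffPoly) :
    timePart ω F s (θ + θ') (p * q) = timePart ω F s θ p * q + p * timePart ω F s θ' q := by
  rcases eq_or_ne s 0 with rfl | hs
  · simp only [timePart_zero, Int.cast_add, mul_smul_comm, smul_mul_assoc, ← add_smul]
    congr 1
    ring
  · simp only [timePart_of_ne_zero _ _ hs, Derivation.leibniz, smul_eq_mul]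
    ring

theorem timeD_mul (ω : ℝ) (F : ℕ → ℕ+ → DiffPoly) (f g : Series) :
    timeD ω F (f * g) = timeD ω F f * g + f * timeD ω F g := by
  refine sub_eq_zero.mp (eq_zero_of_mono₂ (L := fun f g => timeD ω F (f * g) -
      (timeD ω F f * g + f * timeD ω F g)) ?_ ?_ ?_ ?_ ?_ f g)
  · intro f f' g
    simp only [map_add, add_mul]; ring
  · intro f g g'
    simp only [map_add, mul_add]; ring
  · intro f g
    simp only [mul_assoc, timeD, seriesOp_X_mul]; ring
  · intro f g
    simp only [mul_left_comm f, timeD, seriesOp_X_mul]; ring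
  · intro p θ p' θ'
    rw [sub_eq_zero, mono_mul]
    ext n : 1
    rw [map_add, mul_comm (mono p θ)]
    rw [timeD, coeff_seriesOp_mono, mono, mono, PowerSeries.coeff_mul_C, PowerSeries.coeff_mul_C]
    rw [← mono, ← mono, coeff_seriesOp_mono, coeff_seriesOp_mono, timePart_mul, map_add, map_mul,
      map_mul, LaurentPolynomial.T_add]
    ring

theorem timeD_smul (ω : ℝ) (F : ℕ → ℕ+ → DiffPoly) (a : ℂ) (f : Series) :
    timeD ω F (a • f) = a • timeD ω F f :=
  seriesOp_smul _ _ _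

theorem timeD_one (ω : ℝ) (F : ℕ → ℕ+ → DiffPoly) : timeD ω F 1 = 0 := by
  have := timeD_mul ω F 1 1
  simpa using this

theorem timeD_shift (ω : ℝ) (F : ℕ → ℕ+ → DiffPoly) (x : ℝ) (σ : ℤ) (f : Series) :
    timeD ω F (shift x σ f) = shift x σ (timeD ω F f) := by
  refine seriesOp_comm (fun k l θ p => ?_) f
  rw [shiftPart_apply, shiftPart_apply, map_smul]
  congr 1
  rcases eq_or_ne k 0 with rfl | hk
  · simp only [timePart_zero, dxPow_smul]
  · simp [timePart_of_ne_zero _ _ hk, evol_dxPow]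

/-! ### Conjugation -/

/-- Complex conjugation of Laurent polynomials in the harmonic variable. -/
def barLaurent : DiffPoly[T;T⁻¹] →+* DiffPoly[T;T⁻¹] :=
  (LaurentPolynomial.invert (R := DiffPoly)).toRingEquiv.toRingHom.comp
    (AddMonoidAlgebra.mapRingHom ℤ bar)

/-- Complex conjugation of formal series. -/
def barSeries : Series →+* Series := PowerSeries.map barLaurent

theorem cf_barSeries (f : Series) (n : ℕ) (θ : ℤ) :
    cf (barSeries f) n θ = bar (cf f n (-θ)) := by
  simp [cf, barSeries, barLaurent]

theorem barSeries_shift (x : ℝ) (σ : ℤ) (f : Series) :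
    barSeries (shift x σ f) = shift x σ (barSeries f) := by
  refine cf_ext fun n θ => ?_
  rw [cf_barSeries, cf_shift, cf_shift, map_sum]
  refine Finset.sum_congr rfl fun k _ => ?_
  rw [bar_smul, cf_barSeries, dxPow_bar]
  congr 1
  simp [← Complex.exp_conj]

theorem barSeries_timeD (ω : ℝ) (F : ℕ → ℕ+ → DiffPoly) (f : Series) :
    barSeries (timeD ω F f) = timeD ω F (barSeries f) := by
  refine cf_ext fun n θ => ?_
  rw [cf_barSeries, cf_timeD, cf_timeD, map_add, map_sum, bar_smul, cf_barSeries]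
  congr 1
  · simp
  · exact Finset.sum_congr rfl fun s _ => by rw [cf_barSeries, evol_bar]

theorem barSeries_smul (a : ℂ) (f : Series) : barSeries (a • f) = conj a • barSeries f := by
  refine cf_ext fun n θ => ?_
  simp [cf_barSeries, bar_smul]

/-! ### Series with coefficients in a multiplicative family of spaces -/

/-- A family of spaces of differential polynomials, one for each order and harmonic, that is
compatible with products and with `∂`. -/
structure IsMulFamily (K : ℕ → ℤ → Submodule ℂ DiffPoly) : Prop where
  one : 1 ∈ K 0 0
  mul : ∀ {m n a b p q}, p ∈ K m a → q ∈ K n b → p * q ∈ K (m + n) (a + b)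
  dx : ∀ {n a p}, p ∈ K n a → dx p ∈ K (n + 1) a

/-- All coefficients belong to the family. -/
def InFamily (K : ℕ → ℤ → Submodule ℂ DiffPoly) (f : Series) : Prop := ∀ n θ, cf f n θ ∈ K n θ

namespace IsMulFamily

variable {K : ℕ → ℤ → Submodule ℂ DiffPoly}

theorem coeff_mul_mem (hK : IsMulFamily K) {x y : DiffPoly[T;T⁻¹]} {m n : ℕ}
    (hx : ∀ θ, x.coeff θ ∈ K m θ)
    (hy : ∀ θ, y.coeff θ ∈ K n θ) (θ : ℤ) : (x * y).coeff θ ∈ K (m + n) θ := by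
  classical
  rw [AddMonoidAlgebra.coeff_mul]
  refine Submodule.sum_mem _ fun a _ => Submodule.sum_mem _ fun b _ => ?_
  dsimp only
  split_ifs with h
  · exact h ▸ hK.mul (hx a) (hy b)
  · exact Submodule.zero_mem _

theorem mul_inFamily (hK : IsMulFamily K) {f g : Series} (hf : InFamily K f) (hg : InFamily K g) :
    InFamily K (f * g) := by
  intro n θ
  rw [cf, PowerSeries.coeff_mul, AddMonoidAlgebra.coeff_sum, Finset.sum_apply']
  refine Submodule.sum_mem _ fun ij hij => ?_
  rw [← Finset.HasAntidiagonal.mem_antidiagonal.mp hij]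
  exact hK.coeff_mul_mem (hf ij.1) (hg ij.2) θ

theorem one_inFamily (hK : IsMulFamily K) : InFamily K 1 := by
  intro n θ
  rw [cf_one]
  split_ifs with h
  · rw [h.1, h.2]
    exact hK.one
  · exact Submodule.zero_mem _

theorem _root_.MultiScale.InFamily.sub {f g : Series} (hf : InFamily K f) (hg : InFamily K g) :
    InFamily K (f - g) := fun n θ => by
  rw [cf_sub]
  exact Submodule.sub_mem _ (hf n θ) (hg n θ)

theorem inverse_inFamily (hK : IsMulFamily K) {f g : Series} (hf : InFamily K f)
    (hf0 : PowerSeries.constantCoeff f = 1)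
    (hfg : f * g = 1) : InFamily K g := by
  intro n
  induction n using Nat.strong_induction_on with
  | _ n ih =>
    intro θ
    -- As `f - 1` has no constant term, this expresses each coefficient of `g` through earlier ones.
    have h1 : g = 1 - (f - 1) * g := by rw [sub_mul, hfg]; ring
    rw [h1, cf_sub]
    refine Submodule.sub_mem _ (hK.one_inFamily n θ) ?_
    rw [cf, PowerSeries.coeff_mul, AddMonoidAlgebra.coeff_sum, Finset.sum_apply']
    refine Submodule.sum_mem _ fun ij hij => ?_
    obtain ⟨i, j⟩ := ij
    obtain rfl : i + j = n := by simpa using hij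
    rcases Nat.eq_zero_or_pos i with rfl | hi
    · have : PowerSeries.coeff 0 (f - 1) = 0 := by simp [hf0]
      rw [this]
      simp
    · exact hK.coeff_mul_mem ((hf.sub hK.one_inFamily) i) (ih j (by omega)) θ

theorem dxPow_mem (hK : IsMulFamily K) {n : ℕ} {a : ℤ} {p : DiffPoly} (hp : p ∈ K n a) (k : ℕ) :
    dxPow k p ∈ K (n + k) a := by
  induction k with
  | zero => simpa
  | succ k ih => rw [dxPow_succ, ← add_assoc]; exact hK.dx ih

theorem shift_inFamily (hK : IsMulFamily K) {f : Series} (hf : InFamily K f) (x : ℝ) (σ : ℤ) :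
    InFamily K (shift x σ f) := by
  intro n θ
  rw [cf_shift]
  refine Submodule.sum_mem _ fun k hk => Submodule.smul_mem _ _ ?_
  have := hK.dxPow_mem (hf (n - k) θ) k
  rwa [Nat.sub_add_cancel (Nat.lt_succ_iff.mp (Finset.mem_range.mp hk))] at this

end IsMulFamily

/-- Order `n` and gauge `θ`. -/
def gradedFamily (n : ℕ) (θ : ℤ) : Submodule ℂ DiffPoly :=
  MvPolynomial.weightedHomogeneousSubmodule ℂ jetWeight (n, θ)

theorem isMulFamily_graded : IsMulFamily gradedFamily where
  one := MvPolynomial.isWeightedHomogeneous_one ℂ jetWeight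
  mul hp hq := MvPolynomial.IsWeightedHomogeneous.mul hp hq
  dx hp := IsGraded.dx hp

theorem isMulFamily_upTo (μ : ℕ) : IsMulFamily fun _ _ => (upTo μ).toSubmodule where
  one := (upTo μ).one_mem
  mul hp hq := (upTo μ).mul_mem hp hq
  dx hp := dx_mem_upTo hp

/-! ### Constraints imposed by order and gauge. -/

theorem IsGraded.bar {p : DiffPoly} {n : ℕ} {θ : ℤ} (hp : IsGraded p n θ) :
    IsGraded (bar p) n (-θ) := by
  rw [p.as_sum, map_sum]
  refine MvPolynomial.IsWeightedHomogeneous.sum _ _ _ fun m hm => ?_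
  have h1 := hp (MvPolynomial.mem_support_iff.mp hm)
  have h2 : MultiScale.bar (MvPolynomial.monomial m (p.coeff m)) =
      MvPolynomial.monomial (m.mapDomain fun v : Jet => (v.1, v.2.1, !v.2.2))
        (conj (p.coeff m)) := by
    simp [MultiScale.bar, MvPolynomial.map_monomial, MvPolynomial.rename_monomial]
  rw [h2]
  refine MvPolynomial.isWeightedHomogeneous_monomial _ _ _ ?_
  have h3 : ∀ v : Jet, jetWeight (v.1, v.2.1, !v.2.2) =
      ((AddMonoidHom.id ℕ).prodMap (negAddMonoidHom : ℤ →+ ℤ)) (jetWeight v) := by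
    intro v
    cases hv : v.2.2 <;> simp [jetWeight, hv]
  rw [Finsupp.weight_apply, Finsupp.sum_mapDomain_index (by simp) (by intros; rw [add_smul])]
  simp only [h3, ← map_nsmul]
  rw [← map_finsuppSum, ← Finsupp.weight_apply, h1]
  simp

theorem bar_mem_upTo {p : DiffPoly} {μ : ℕ} (hp : p ∈ upTo μ) : bar p ∈ upTo μ := by
  change p ∈ (MvPolynomial.supported ℂ _ : Subalgebra ℂ DiffPoly) at hp
  rw [MvPolynomial.supported_eq_adjoin_X] at hp
  induction hp using Algebra.adjoin_induction with
  | mem x hx =>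
    obtain ⟨v, hv, rfl⟩ := hx
    rw [bar_X]
    exact MvPolynomial.X_mem_supported.mpr hv
  | algebraMap r =>
    rw [MvPolynomial.algebraMap_eq, bar_C]
    exact (upTo μ).algebraMap_mem _
  | add x y _ _ hx hy => rw [map_add]; exact add_mem hx hy
  | mul x y _ _ hx hy => rw [map_mul]; exact mul_mem hx hy

theorem natAbs_gaugeWeight_le (m : Jet →₀ ℕ) : |gaugeWeight m| ≤ epsOrder m := by
  rw [gaugeWeight, epsOrder, Finsupp.sum, Finsupp.sum]
  push_cast
  refine (Finset.abs_sum_le_sum_abs _ _).trans (Finset.sum_le_sum fun v _ => ?_)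
  have h1 : (1 : ℤ) ≤ v.1 := by exact_mod_cast v.1.pos
  have h2 : |if v.2.2 then -(m v : ℤ) else (m v : ℤ)| = m v := by split_ifs <;> simp
  rw [h2]
  nlinarith [Int.natCast_nonneg (m v), Int.natCast_nonneg v.2.1]

/-- Each factor has order at least 1 and gauge `±1`. This yields the bound `|θ| ≤ γ` on the
harmonics of the constructed expansion. -/
theorem IsGraded.eq_zero {p : DiffPoly} {n : ℕ} {θ : ℤ} (hp : IsGraded p n θ)
    (h : (n : ℤ) < |θ|) : p = 0 := by
  by_contra hne
  obtain ⟨m, hm⟩ := MvPolynomial.support_nonempty.mpr hne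
  have h1 := hp (MvPolynomial.mem_support_iff.mp hm)
  rw [weight_jetWeight, Prod.mk.injEq] at h1
  have := natAbs_gaugeWeight_le m
  rw [h1.1, h1.2] at this
  omega

theorem IsGraded.constantCoeff {p : DiffPoly} {n : ℕ} {θ : ℤ} (hp : IsGraded p n θ)
    (h : n ≠ 0) : MvPolynomial.constantCoeff p = 0 := by
  by_contra hne
  rw [MvPolynomial.constantCoeff_eq] at hne
  have := hp hne
  rw [map_zero] at this
  exact h (congrArg Prod.fst this).symm

theorem epsOrder_ge {m : Jet →₀ ℕ} {v : Jet} (hv : v ∈ m.support) :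
    v.2.1 + (v.1 : ℕ) ≤ epsOrder m := by
  rw [epsOrder, Finsupp.sum]
  refine le_trans ?_ (Finset.single_le_sum (f := fun v : Jet => m v * (v.2.1 + (v.1 : ℕ)))
    (fun _ _ => Nat.zero_le _) hv)
  exact Nat.le_mul_of_pos_left _ (Nat.pos_of_ne_zero (Finsupp.mem_support_iff.mp hv))

theorem IsGraded.mem_upTo {p : DiffPoly} {n : ℕ} {θ : ℤ} (hp : IsGraded p n θ) : p ∈ upTo n := by
  rw [MultiScale.mem_upTo]
  intro m hm v hv
  have h1 := hp (MvPolynomial.mem_support_iff.mp hm)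
  rw [weight_jetWeight, Prod.mk.injEq] at h1
  have := epsOrder_ge hv
  omega

/-- Only the first harmonic involves the amplitude of the highest index. -/
theorem IsGraded.mem_upTo_pred {p : DiffPoly} {n : ℕ} {θ : ℤ} (hp : IsGraded p n θ)
    (hθ : θ ≠ 1) (hθ' : θ ≠ -1) : p ∈ upTo (n - 1) := by
  rw [MultiScale.mem_upTo]
  intro m hm v hv
  have h1 := hp (MvPolynomial.mem_support_iff.mp hm)
  rw [weight_jetWeight, Prod.mk.injEq] at h1
  by_contra hlt
  have h2 := epsOrder_ge hv
  have hv1 : Finsupp.single v 1 ≤ m := by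
    rw [Finsupp.single_le_iff]
    exact Nat.one_le_iff_ne_zero.mpr (Finsupp.mem_support_iff.mp hv)
  have hm' : m = (m - Finsupp.single v 1) + Finsupp.single v 1 := (tsub_add_cancel_of_le hv1).symm
  set m' := m - Finsupp.single v 1
  have hw := weight_jetWeight m
  rw [hm', map_add, Finsupp.weight_single, one_smul, weight_jetWeight, ← hm', h1.1, h1.2] at hw
  have hw1 : epsOrder m' + (v.2.1 + (v.1 : ℕ)) = n := congrArg Prod.fst hw
  have hw2 : gaugeWeight m' + (if v.2.2 then -1 else 1) = θ := congrArg Prod.snd hw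
  have hv0 := v.1.pos
  have h3 := natAbs_gaugeWeight_le m'
  -- A jet of index at least `n` uses up the whole order, so it is the only factor and the gauge
  -- would be `±1`.
  have h4 : epsOrder m' = 0 := by omega
  rw [h4, Nat.cast_zero, abs_nonpos_iff] at h3
  rw [h3] at hw2
  split_ifs at hw2 <;> omega

/-! ### The Hopf–Cole transformation -/

/-- The series `∑_j ε^j (W_j E + W̄_j E⁻¹)`. -/
def firstHarmonic (W : ℕ → DiffPoly) : Series := PowerSeries.mk fun j =>
  LaurentPolynomial.C (W j) * LaurentPolynomial.T 1 +
    LaurentPolynomial.C (bar (W j)) * LaurentPolynomial.T (-1)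

theorem cf_firstHarmonic (W : ℕ → DiffPoly) (n : ℕ) (θ : ℤ) :
    cf (firstHarmonic W) n θ = if θ = 1 then W n else if θ = -1 then bar (W n) else 0 := by
  rw [cf, firstHarmonic, PowerSeries.coeff_mk, ← LaurentPolynomial.single_eq_C_mul_T,
    ← LaurentPolynomial.single_eq_C_mul_T, AddMonoidAlgebra.coeff_add, Finsupp.add_apply,
    AddMonoidAlgebra.coeff_single, AddMonoidAlgebra.coeff_single, Finsupp.single_apply,
    Finsupp.single_apply]
  split_ifs <;> first | omega | simp

/-- The Hopf–Cole potential. -/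
def potential (W : ℕ → DiffPoly) : Series := 1 + firstHarmonic W

/-- The inverse of the Hopf–Cole potential. -/
def potentialInv (W : ℕ → DiffPoly) : Series := PowerSeries.invOfUnit (potential W) 1

/-- The Hopf–Cole transform of the potential. -/
def hopfCole (h x : ℝ) (W : ℕ → DiffPoly) : Series :=
  ((h : ℂ)⁻¹) • (shift x 1 (potential W) * potentialInv W - 1)

theorem constantCoeff_potential {W : ℕ → DiffPoly} (hW : W 0 = 0) :
    PowerSeries.constantCoeff (potential W) = 1 := by
  simp [potential, firstHarmonic, hW]

theorem constantCoeff_shift {f : Series} (x : ℝ) (σ : ℤ)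
    (hf : PowerSeries.constantCoeff f = 1) : PowerSeries.constantCoeff (shift x σ f) = 1 := by
  have h1 : f = 1 + PowerSeries.X ^ 1 * PowerSeries.mk fun p => PowerSeries.coeff (p + 1) f := by
    conv_lhs => rw [PowerSeries.eq_X_mul_shift_add_const f, hf, map_one]
    ring
  rw [h1, map_add, map_one, shift_X_pow_mul]
  simp

theorem potential_mul_inv {W : ℕ → DiffPoly} (hW : W 0 = 0) :
    potential W * potentialInv W = 1 :=
  PowerSeries.mul_invOfUnit _ _ (by rw [constantCoeff_potential hW, Units.val_one])

theorem constantCoeff_potentialInv {W : ℕ → DiffPoly} (hW : W 0 = 0) :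
    PowerSeries.constantCoeff (potentialInv W) = 1 := by
  have := congrArg PowerSeries.constantCoeff (potential_mul_inv hW)
  rwa [map_mul, constantCoeff_potential hW, one_mul, map_one] at this

theorem coeff_X_pow_mul_self (f : Series) (n : ℕ) :
    PowerSeries.coeff n (PowerSeries.X ^ n * f) = PowerSeries.constantCoeff f := by
  have := PowerSeries.coeff_X_pow_mul f n 0
  simpa using this

/-- The dependence of the Hopf–Cole transform on the leading new coefficient. -/
theorem cf_hopfCole_sub (h x : ℝ) {W W' : ℕ → DiffPoly} (hW : W 0 = 0) (hW' : W' 0 = 0) {j : ℕ}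
    (hj : ∀ i < j, W i = W' i) :
    cf (hopfCole h x W) j 1 - cf (hopfCole h x W') j 1 =
      ((h : ℂ)⁻¹ * (Complex.exp (Complex.I * x) - 1)) • (W j - W' j) := by
  obtain ⟨d, hd⟩ : PowerSeries.X ^ j ∣ potential W - potential W' := by
    rw [PowerSeries.X_pow_dvd_iff]
    intro m hm
    simp [potential, firstHarmonic, hj m hm]
  have hp := potential_mul_inv hW
  have hp' := potential_mul_inv hW'
  have key : hopfCole h x W - hopfCole h x W' = ((h : ℂ)⁻¹) • (PowerSeries.X ^ j *
      (shift x 1 d * potentialInv W -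
        shift x 1 (potential W') * potentialInv W * potentialInv W' * d)) := by
    have h1 : shift x 1 (potential W) = shift x 1 (potential W') +
        PowerSeries.X ^ j * shift x 1 d := by
      rw [← shift_X_pow_mul, ← hd, map_sub]; ring
    rw [hopfCole, hopfCole, ← smul_sub, h1]
    congr 1
    linear_combination -(shift x 1 (potential W') * potentialInv W * potentialInv W') * hd
      - (shift x 1 (potential W') * potentialInv W) * hp'
      + (shift x 1 (potential W') * potentialInv W') * hp
  -- All factors other than `d` and its shift have constant term 1, so only the linear part of the
  -- transform survives at leading order.
  have hc : PowerSeries.constantCoeff (shift x 1 d * potentialInv W -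
      shift x 1 (potential W') * potentialInv W * potentialInv W' * d) =
      PowerSeries.constantCoeff (shift x 1 d) - PowerSeries.constantCoeff d := by
    simp only [map_sub, map_mul, constantCoeff_potentialInv hW, constantCoeff_potentialInv hW',
      constantCoeff_shift x 1 (constantCoeff_potential hW')]
    ring
  have hd0 : cf d 0 1 = W j - W' j := by
    have h1 : cf d 0 1 = cf (potential W - potential W') j 1 := by
      rw [hd, cf, cf, coeff_X_pow_mul_self, PowerSeries.coeff_zero_eq_constantCoeff_apply]
    rw [h1, potential, potential, add_sub_add_left_eq_sub, cf_sub, cf_firstHarmonic,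
      cf_firstHarmonic, if_pos rfl, if_pos rfl]
  have hS : cf (shift x 1 d) 0 1 = Complex.exp (Complex.I * x) • cf d 0 1 := by
    rw [cf_shift]
    simp
  rw [← cf_sub, key, cf_smul, cf, coeff_X_pow_mul_self, hc, AddMonoidAlgebra.coeff_sub,
    Finsupp.sub_apply, ← PowerSeries.coeff_zero_eq_constantCoeff_apply,
    ← PowerSeries.coeff_zero_eq_constantCoeff_apply]
  change (h : ℂ)⁻¹ • (cf (shift x 1 d) 0 1 - cf d 0 1) = _
  rw [hS, hd0, mul_smul, sub_smul, one_smul]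

/-- The amplitudes of the potential whose Hopf–Cole transform has first harmonics `u_j`. -/
def hopfAmp (h x : ℝ) (n : ℕ) : DiffPoly :=
  if hn : 0 < n then
    ((h : ℂ) * (Complex.exp (Complex.I * x) - 1)⁻¹) •
      (u ⟨n, hn⟩ - cf (hopfCole h x fun i => if _ : i < n then hopfAmp h x i else 0) n 1)
  else 0

/-- The correction to `u_n` in terms of the previous amplitudes. -/
def hopfCorrection (h x : ℝ) (n : ℕ) : DiffPoly :=
  cf (hopfCole h x fun i => if i < n then hopfAmp h x i else 0) n 1

theorem hopfAmp_zero (h x : ℝ) : hopfAmp h x 0 = 0 := by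
  rw [hopfAmp]; simp

theorem hopfAmp_pos (h x : ℝ) (j : ℕ+) :
    hopfAmp h x j = ((h : ℂ) * (Complex.exp (Complex.I * x) - 1)⁻¹) •
      (u j - hopfCorrection h x j) := by
  rw [hopfAmp, dif_pos j.pos]
  simp only [hopfCorrection, dite_eq_ite]
  rfl

theorem cf_hopfCole_one {h x : ℝ} (hh : h ≠ 0) (hx : Complex.exp (Complex.I * x) ≠ 1) (j : ℕ+) :
    cf (hopfCole h x (hopfAmp h x)) j 1 = u j := by
  have h1 := cf_hopfCole_sub h x (W := hopfAmp h x)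
    (W' := fun i => if i < (j : ℕ) then hopfAmp h x i else 0) (j := j) (hopfAmp_zero h x)
    (by simp [hopfAmp_zero]) (fun i hi => by simp [hi])
  have h2 : (h : ℂ) ≠ 0 := by exact_mod_cast hh
  have h3 : Complex.exp (Complex.I * x) - 1 ≠ 0 := sub_ne_zero.mpr hx
  rw [if_neg (lt_irrefl _), sub_zero, hopfAmp_pos, smul_smul] at h1
  have h4 : (h : ℂ)⁻¹ * (Complex.exp (Complex.I * x) - 1) *
      ((h : ℂ) * (Complex.exp (Complex.I * x) - 1)⁻¹) = 1 := by field_simp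
  rw [h4, one_smul] at h1
  exact sub_left_inj.mp h1

/-- The transform arises from the `W j` by products, a shift and one inversion, all of which respect
a multiplicative family. It serves both for the bigrading and for the bound on the indices. -/
theorem hopfCole_inFamily {K : ℕ → ℤ → Submodule ℂ DiffPoly} (hK : IsMulFamily K) (h x : ℝ)
    {W : ℕ → DiffPoly} (hW : W 0 = 0) (h1 : ∀ j, W j ∈ K j 1) (h2 : ∀ j, bar (W j) ∈ K j (-1)) :
    InFamily K (hopfCole h x W) := by
  have hp : InFamily K (potential W) := by
    intro n θ
    rw [potential, cf_add]
    refine Submodule.add_mem _ (hK.one_inFamily n θ) ?_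
    rw [cf_firstHarmonic]
    split_ifs with h3 h4
    · exact h3 ▸ h1 n
    · exact h4 ▸ h2 n
    · exact Submodule.zero_mem _
  have hi := hK.inverse_inFamily hp (constantCoeff_potential hW) (potential_mul_inv hW)
  intro n θ
  rw [hopfCole, cf_smul]
  exact Submodule.smul_mem _ _
    (((hK.mul_inFamily (hK.shift_inFamily hp x 1) hi).sub hK.one_inFamily) n θ)

theorem isGraded_u (j : ℕ+) : IsGraded (u j) j 1 := by
  simpa [u] using isGraded_X (j, 0, false)

theorem isGraded_hopfAmp (h x : ℝ) (n : ℕ) : IsGraded (hopfAmp h x n) n 1 := by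
  induction n using Nat.strong_induction_on with
  | _ n ih =>
    rcases Nat.eq_zero_or_pos n with rfl | hn
    · rw [hopfAmp_zero]
      exact MvPolynomial.isWeightedHomogeneous_zero _ _ _
    · have hW : ∀ i, IsGraded (if i < n then hopfAmp h x i else 0) i 1 := by
        intro i
        split_ifs with hi
        · exact ih i hi
        · exact MvPolynomial.isWeightedHomogeneous_zero _ _ _
      have := hopfCole_inFamily isMulFamily_graded h x (by simp [hopfAmp_zero]) hW
        (fun i => (hW i).bar) n 1
      lift n to ℕ+ using hn
      rw [hopfAmp_pos]
      exact IsGraded.smul ((isGraded_u n).sub this) _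

theorem isGraded_hopfCorrection (h x : ℝ) (n : ℕ) : IsGraded (hopfCorrection h x n) n 1 := by
  have hW : ∀ i, IsGraded (if i < n then hopfAmp h x i else 0) i 1 := by
    intro i
    split_ifs with hi
    · exact isGraded_hopfAmp h x i
    · exact MvPolynomial.isWeightedHomogeneous_zero _ _ _
  exact hopfCole_inFamily isMulFamily_graded h x (by simp [hopfAmp_zero]) hW
    (fun i => (hW i).bar) n 1

theorem hopfCorrection_mem_upTo (h x : ℝ) (n : ℕ) : hopfCorrection h x n ∈ upTo (n - 1) := by
  have hW : ∀ i, (if i < n then hopfAmp h x i else 0) ∈ upTo (n - 1) := by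
    intro i
    split_ifs with hi
    · have := (isGraded_hopfAmp h x i).mem_upTo
      rw [mem_upTo] at this ⊢
      exact fun m hm v hv => (this m hm v hv).trans (by omega)
    · exact zero_mem _
  exact hopfCole_inFamily (isMulFamily_upTo (n - 1)) h x (by simp [hopfAmp_zero]) hW
    (fun i => bar_mem_upTo (hW i)) n 1

theorem isGraded_cf_hopfCole (h x : ℝ) (n : ℕ) (θ : ℤ) :
    IsGraded (cf (hopfCole h x (hopfAmp h x)) n θ) n θ :=
  hopfCole_inFamily isMulFamily_graded h x (hopfAmp_zero h x) (isGraded_hopfAmp h x)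
    (fun i => (isGraded_hopfAmp h x i).bar) n θ

theorem cf_hopfCole_zero (h x : ℝ) {W : ℕ → DiffPoly} (hW : W 0 = 0) (θ : ℤ) :
    cf (hopfCole h x W) 0 θ = 0 := by
  rw [hopfCole, cf_smul, cf, PowerSeries.coeff_zero_eq_constantCoeff_apply, map_sub, map_mul,
    constantCoeff_potentialInv hW, constantCoeff_shift x 1 (constantCoeff_potential hW)]
  simp

theorem barSeries_firstHarmonic (W : ℕ → DiffPoly) :
    barSeries (firstHarmonic W) = firstHarmonic W := by
  refine cf_ext fun n θ => ?_
  rw [cf_barSeries, cf_firstHarmonic, cf_firstHarmonic]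
  split_ifs <;> first | omega | simp

theorem barSeries_potential (W : ℕ → DiffPoly) : barSeries (potential W) = potential W := by
  rw [potential, map_add, map_one, barSeries_firstHarmonic]

/-- The potential is real and inverses are unique, so its inverse is real as well. -/
theorem barSeries_hopfCole (h x : ℝ) {W : ℕ → DiffPoly} (hW : W 0 = 0) :
    barSeries (hopfCole h x W) = hopfCole h x W := by
  have h1 : barSeries (potentialInv W) = potentialInv W := by
    have h2 := congrArg barSeries (potential_mul_inv hW)
    rw [map_mul, map_one, barSeries_potential] at h2
    linear_combination potentialInv W * h2 - barSeries (potentialInv W) * potential_mul_inv hW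
  rw [hopfCole, barSeries_smul, map_sub, map_mul, barSeries_shift, barSeries_potential, h1,
    map_one]
  simp

/-- The Hopf–Cole transformation linearizes the Burgers equation. -/
theorem timeD_hopfCole {h : ℝ} (hh : h ≠ 0) (x ω : ℝ) (F : ℕ → ℕ+ → DiffPoly)
    {W : ℕ → DiffPoly} (hW : W 0 = 0) {m : ℕ} {r : Series}
    (hr : timeD ω F (potential W) = ((1 / (2 * h) : ℝ) : ℂ) •
      (shift x 1 (potential W) - shift x (-1) (potential W)) + PowerSeries.X ^ m * r)
    {q : Series} (hq : (1 + (h : ℂ) • shift x (-1) (hopfCole h x W)) * q = 1) :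
    ∃ r', timeD ω F (hopfCole h x W) = ((1 / (2 * h) : ℝ) : ℂ) •
      ((1 + (h : ℂ) • hopfCole h x W) * (shift x 1 (hopfCole h x W) - hopfCole h x W) -
        (shift x (-1) (hopfCole h x W) - hopfCole h x W) * q) + PowerSeries.X ^ m * r' := by
  have hc : (h : ℂ) ≠ 0 := by exact_mod_cast hh
  set p := potential W with hp_def
  set i := potentialInv W with hi_def
  have hp : p * i = 1 := potential_mul_inv hW
  have hpp : shift x 1 p * shift x 1 i = 1 := by rw [← map_mul, hp, map_one]
  have hpm : shift x (-1) p * shift x (-1) i = 1 := by rw [← map_mul, hp, map_one]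
  have hUp : shift x 1 (hopfCole h x W) =
      (h : ℂ)⁻¹ • (shift x 1 (shift x 1 p) * shift x 1 i - 1) := by
    rw [hopfCole, shift_smul, map_sub, map_mul, map_one]
  have hUm : shift x (-1) (hopfCole h x W) = (h : ℂ)⁻¹ • (p * shift x (-1) i - 1) := by
    rw [hopfCole, shift_smul, map_sub, map_mul, map_one, shift_shift]
    simp [shift_zero, hp_def, hi_def]
  -- Since `1 + h u_{n-1} = p_n / p_{n-1}`, its inverse is `p_{n-1} / p_n`.
  have hq' : q = shift x (-1) p * i := by
    rw [hUm, smul_smul, mul_inv_cancel₀ hc, one_smul, add_sub_cancel] at hq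
    linear_combination (i * shift x (-1) p) * hq - q * hp * (shift x (-1) p * shift x (-1) i)
      - q * hpm
  have hi : timeD ω F i = -(i * i * timeD ω F p) := by
    have h1 := congrArg (timeD ω F) hp
    rw [timeD_mul, timeD_one] at h1
    linear_combination i * h1 - timeD ω F i * hp
  have hSp : timeD ω F (shift x 1 p) = ((1 / (2 * h) : ℝ) : ℂ) •
      (shift x 1 (shift x 1 p) - p) + PowerSeries.X ^ m * shift x 1 r := by
    rw [timeD_shift, hr, map_add, shift_smul, map_sub, shift_shift x 1 (-1), shift_X_pow_mul]
    simp [shift_zero]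
  -- This is the quotient rule applied to the error in the linear equation; the factor `ε^m` is
  -- kept.
  refine ⟨(h : ℂ)⁻¹ • (shift x 1 r * i - shift x 1 p * i * i * r), ?_⟩
  have hU1 : (1 + (h : ℂ) • hopfCole h x W) = shift x 1 p * i := by
    rw [hopfCole, smul_smul, mul_inv_cancel₀ hc, one_smul, add_sub_cancel]
  have hD : timeD ω F (hopfCole h x W) =
      (h : ℂ)⁻¹ • (timeD ω F (shift x 1 p) * i + shift x 1 p * timeD ω F i) := by
    rw [hopfCole, timeD_smul, map_sub, timeD_one, sub_zero, timeD_mul]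
  rw [hU1, hD, hi, hSp, hr, hUp, hUm, hq', hopfCole, ← smul_sub, ← smul_sub]
  simp only [Algebra.smul_def]
  set a := algebraMap ℂ Series ((1 / (2 * h) : ℝ) : ℂ)
  set b := algebraMap ℂ Series ((h : ℂ)⁻¹)
  linear_combination -(b * a * shift x 1 (shift x 1 p) * i) * hpp + b * a * p * i * hpm

/-! ### Differential polynomials of low order -/

/-- Linear combinations of the jet variables `∂^m u_j`, `j ≤ μ`. -/
def linearSpan (μ : ℕ) : Submodule ℂ DiffPoly :=
  Submodule.span ℂ {p | ∃ (j : ℕ+) (m : ℕ), (j : ℕ) ≤ μ ∧ p = MvPolynomial.X (j, m, false)}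

theorem degree_le_epsOrder (m : Jet →₀ ℕ) : m.degree ≤ epsOrder m := by
  rw [Finsupp.degree_apply, epsOrder, Finsupp.sum]
  refine Finset.sum_le_sum fun v _ => Nat.le_mul_of_pos_right _ ?_
  have := v.1.pos
  omega

/-- Each factor contributes 2 or 0. Hence gauge 1 forces odd degree and excludes quadratic terms. -/
theorem gaugeWeight_add_degree (m : Jet →₀ ℕ) : (2 : ℤ) ∣ gaugeWeight m + m.degree := by
  rw [gaugeWeight, Finsupp.degree_apply, Finsupp.sum]
  push_cast
  rw [← Finset.sum_add_distrib]
  refine Finset.dvd_sum fun v _ => ?_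
  split_ifs
  · simp
  · exact ⟨m v, by ring⟩

/-- The exponent of the cubic term. -/
def cubicExponent : Jet →₀ ℕ := Finsupp.single (1, 0, false) 2 + Finsupp.single (1, 0, true) 1

theorem cubic_eq_monomial : cubic = MvPolynomial.monomial cubicExponent 1 := by
  have h : (MvPolynomial.monomial cubicExponent (1 : ℂ)) =
      MvPolynomial.X (1, 0, false) ^ 2 * MvPolynomial.X (1, 0, true) := by
    rw [MvPolynomial.X_pow_eq_monomial, MvPolynomial.X, MvPolynomial.monomial_mul, one_mul,
      cubicExponent]
  rw [h, cubic, u, bar_X]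
  simp only [Bool.not_false]
  ring

/-- The degree is odd and at most the order, so it is 1 or 3. Three factors within order 3 leave no
room for derivatives or higher indices, and the gauge fixes which factor is conjugated. -/
theorem exponent_of_low_order {m : Jet →₀ ℕ} (h3 : epsOrder m ≤ 3) (h1 : gaugeWeight m = 1) :
    (∃ (j : ℕ+) (k : ℕ), m = Finsupp.single (j, k, false) 1) ∨ m = cubicExponent := by
  have hd := degree_le_epsOrder m
  have hg := gaugeWeight_add_degree m
  rw [h1] at hg
  have hcases : m.degree = 1 ∨ m.degree = 3 := by omega
  rcases hcases with hm | hm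
  · left
    obtain ⟨v, hv⟩ : m.support.Nonempty := by
      rw [Finsupp.support_nonempty_iff]
      rintro rfl
      simp at hm
    have hv1 : Finsupp.single v 1 ≤ m := by
      rw [Finsupp.single_le_iff]
      exact Nat.one_le_iff_ne_zero.mpr (Finsupp.mem_support_iff.mp hv)
    have h2 := tsub_add_cancel_of_le hv1
    have h4 : (m - Finsupp.single v 1).degree = 0 := by
      have := congrArg Finsupp.degree h2
      rw [map_add, hm, Finsupp.degree_single] at this
      omega
    rw [(Finsupp.degree_eq_zero_iff _).mp h4, zero_add] at h2
    obtain ⟨j, k, b⟩ := v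
    subst h2
    cases b
    · exact ⟨j, k, rfl⟩
    · simp [gaugeWeight] at h1
  · right
    have he : epsOrder m = 3 := by omega
    have hv : ∀ v ∈ m.support, v.2.1 + (v.1 : ℕ) = 1 := by
      intro v hv
      by_contra hne
      have h2 : m.degree < epsOrder m := by
        rw [Finsupp.degree_apply, epsOrder, Finsupp.sum]
        refine Finset.sum_lt_sum (fun w _ => Nat.le_mul_of_pos_right _ ?_) ⟨v, hv, ?_⟩
        · have := w.1.pos
          omega
        · have h4 := Nat.pos_of_ne_zero (Finsupp.mem_support_iff.mp hv)
          have h5 : 1 < v.2.1 + (v.1 : ℕ) := by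
            have := v.1.pos
            omega
          exact (Nat.lt_mul_iff_one_lt_right h4).mpr h5
      omega
    have hsupp : m.support ⊆ {(1, 0, false), (1, 0, true)} := by
      rintro ⟨j, k, b⟩ hm'
      have h5 := hv _ hm'
      have h6 := j.pos
      have hj : j = 1 := PNat.coe_eq_one_iff.mp (by simp at h5; omega)
      have hk : k = 0 := by simp at h5; omega
      subst hj hk
      cases b <;> simp
    have hne : ((1, 0, false) : Jet) ≠ (1, 0, true) := by simp
    rw [Finsupp.degree_apply, Finset.sum_subset hsupp (by simp), Finset.sum_pair hne] at hm
    rw [gaugeWeight, Finsupp.sum_of_support_subset _ hsupp _ (by simp), Finset.sum_pair hne] at h1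
    simp only [Bool.false_eq_true, if_false, if_true] at h1
    ext v
    by_cases hv1 : v = (1, 0, false)
    · subst hv1
      simp [cubicExponent]
      omega
    by_cases hv2 : v = (1, 0, true)
    · subst hv2
      simp [cubicExponent]
      omega
    rw [Finsupp.notMem_support_iff.mp fun h => by simpa [hv1, hv2] using hsupp h]
    simp [cubicExponent, Ne.symm hv1, Ne.symm hv2]

theorem mem_linearSpan_of_low_order {p : DiffPoly} {n μ : ℕ} (hn : n ≤ 3) (hp : IsGraded p n 1)
    (hp' : p ∈ upTo μ) (hc : p.coeff cubicExponent = 0) : p ∈ linearSpan μ := by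
  rw [p.as_sum]
  refine Submodule.sum_mem _ fun m hm => ?_
  have h1 := hp (MvPolynomial.mem_support_iff.mp hm)
  rw [weight_jetWeight, Prod.mk.injEq] at h1
  rcases exponent_of_low_order (h1.1.le.trans hn) h1.2 with ⟨j, k, h2⟩ | h2
  · have h3 : MvPolynomial.monomial m (p.coeff m) =
        p.coeff m • (MvPolynomial.X (j, k, false) : DiffPoly) := by
      rw [h2, MvPolynomial.X, MvPolynomial.smul_monomial, smul_eq_mul, mul_one]
    rw [h3]
    refine Submodule.smul_mem _ _ (Submodule.subset_span ⟨j, k, ?_, rfl⟩)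
    exact mem_upTo.mp hp' m hm (j, k, false) (by simp [h2])
  · exact absurd (h2 ▸ hc) (MvPolynomial.mem_support_iff.mp hm)

theorem mem_linearSpan_of_order_two {p : DiffPoly} {n μ : ℕ} (hn : n ≤ 2) (hp : IsGraded p n 1)
    (hp' : p ∈ upTo μ) : p ∈ linearSpan μ := by
  refine mem_linearSpan_of_low_order (by omega) hp hp' ?_
  by_contra h
  have h1 := hp h
  have h2 : IsGraded cubic 3 1 := isGraded_cubic
  rw [cubic_eq_monomial] at h2
  have h3 := h2 (d := cubicExponent) (by simp)
  rw [h1] at h3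
  have := congrArg Prod.fst h3
  simp at this
  omega

/-- The span contains no conjugate jets, so the flow acts with one and the same coefficient
throughout. -/
theorem evol_of_mem_linearSpan {F : ℕ+ → DiffPoly} {B : ℕ → ℝ} {s μ : ℕ}
    (hF : ∀ j : ℕ+, (j : ℕ) ≤ μ → F j = linFlow B s (u j)) {p : DiffPoly}
    (hp : p ∈ linearSpan μ) : evol F p = linFlow B s p := by
  induction hp using Submodule.span_induction with
  | mem x hx =>
    obtain ⟨j, m, hj, rfl⟩ := hx
    rw [evol_X_false, hF j hj, ← dxPow_u]
    simp only [linFlow, dxPow_smul, dxPow_comm s m]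
  | zero => simp [linFlow]
  | add x y _ _ hx hy => rw [map_add, hx, hy, linFlow_add]
  | smul a x _ hx => rw [Derivation.map_smul, hx, linFlow_smul]

/-! ### Construction of an expansion -/

/-- The coefficient of the cubic term in the amplitude `u_3`. -/
def cubicCoeff (h x : ℝ) : ℂ := (hopfCorrection h x 3).coeff cubicExponent

/-- The forcing terms. -/
def forcing (h κ : ℝ) (s : ℕ) (j : ℕ+) : DiffPoly :=
  if j = 3 then cubicCoeff h (κ * h) • linM (burgersB h κ) s cubic else 0

/-- The evolution of the amplitudes. -/
def hopfFlow (h κ : ℝ) (s : ℕ) (j : ℕ+) : DiffPoly :=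
  linFlow (burgersB h κ) s (u j) + forcing h κ s j

theorem linFlow_one (B : ℕ → ℝ) (p : DiffPoly) : linFlow B 1 p = (B 1 : ℂ) • dx p := by
  simp [linFlow]

theorem linM_one (B : ℕ → ℝ) (p : DiffPoly) : linM B 1 p = 0 := by
  simp only [linM, linFlow_one]
  rw [evol_smul_dx (Complex.conj_ofReal _), sub_self]

/-- The operator `M_1` of the transport flow annihilates everything, so the uniform forcing formula
is also correct at `s = 1`. -/
theorem hopfFlow_one (h κ : ℝ) (j : ℕ+) :
    hopfFlow h κ 1 j = (burgersB h κ 1 : ℂ) • dx (u j) := by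
  rw [hopfFlow, linFlow_one, forcing, linM_one, smul_zero, ite_self, add_zero]

theorem hopfFlow_of_ne (h κ : ℝ) (s : ℕ) {j : ℕ+} (hj : j ≠ 3) :
    hopfFlow h κ s j = linFlow (burgersB h κ) s (u j) := by
  rw [hopfFlow, forcing, if_neg hj, add_zero]

theorem hopfFlow_of_le (h κ : ℝ) (s : ℕ) {j : ℕ+} (hj : (j : ℕ) ≤ 2) :
    hopfFlow h κ s j = linFlow (burgersB h κ) s (u j) :=
  hopfFlow_of_ne h κ s (by rintro rfl; exact absurd hj (by decide))

theorem evol_hopfFlow_one (h κ : ℝ) (p : DiffPoly) :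
    evol (hopfFlow h κ 1) p = linFlow (burgersB h κ) 1 p := by
  rw [funext (hopfFlow_one h κ), linFlow_one, evol_smul_dx (Complex.conj_ofReal _)]

theorem upTo_mono {μ ν : ℕ} (h : μ ≤ ν) {p : DiffPoly} (hp : p ∈ upTo μ) : p ∈ upTo ν := by
  rw [mem_upTo] at *
  exact fun m hm v hv => (hp m hm v hv).trans h

/-- The amplitudes of the potential evolve linearly. -/
theorem evol_hopfAmp (h κ : ℝ) {s j : ℕ} (hs : 1 ≤ s) (hsj : s + j ≤ 5) :
    evol (hopfFlow h κ s) (hopfAmp h (κ * h) j) =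
      linFlow (burgersB h κ) s (hopfAmp h (κ * h) j) := by
  rcases eq_or_ne s 1 with rfl | hs1
  · exact evol_hopfFlow_one h κ _
  have hlin : ∀ p ∈ linearSpan 2, evol (hopfFlow h κ s) p = linFlow (burgersB h κ) s p :=
    fun p hp => evol_of_mem_linearSpan (fun j hj => hopfFlow_of_le h κ s hj) hp
  rcases Nat.eq_zero_or_pos j with rfl | hj
  · rw [hopfAmp_zero]
    simp [linFlow]
  lift j to ℕ+ using hj
  rw [hopfAmp_pos, Derivation.map_smul, linFlow_smul, map_sub, linFlow_sub, evol_u]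
  congr 1
  rcases Nat.lt_or_ge j 3 with hj | hj
  · rw [hopfFlow_of_le h κ s (by omega), hlin]
    exact mem_linearSpan_of_order_two (n := j) (by omega) (isGraded_hopfCorrection _ _ _)
      (upTo_mono (by omega) (hopfCorrection_mem_upTo _ _ _))
  -- With `s ≥ 2` and `s + j ≤ 5`, this is the only remaining index.
  · obtain rfl : j = 3 := PNat.coe_injective (by simp; omega)
    rw [hopfFlow, forcing, if_pos rfl]
    have hg : IsGraded (hopfCorrection h (κ * h) 3) 3 1 := isGraded_hopfCorrection h (κ * h) 3
    have hu : hopfCorrection h (κ * h) 3 ∈ upTo 2 := hopfCorrection_mem_upTo h (κ * h) 3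
    have hk : (hopfCorrection h (κ * h) 3).coeff cubicExponent = cubicCoeff h (κ * h) := rfl
    have h30 : ((3 : ℕ+) : ℕ) = 3 := rfl
    rw [h30]
    generalize hopfCorrection h (κ * h) 3 = g at *
    generalize cubicCoeff h (κ * h) = k at *
    -- Apart from the cubic term, the correction is linear in jets of `u(1)` and `u(2)`, which
    -- evolve linearly. The forcing of `u(3)` is exactly the defect `k • linM cubic`, so the two
    -- cancel in `u(3) - g`.
    have h1 : g - k • cubic ∈ linearSpan 2 := by
      refine mem_linearSpan_of_low_order le_rfl (hg.sub (isGraded_cubic.smul k))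
        (sub_mem hu (Subalgebra.smul_mem _ (cubic_mem_upTo (by norm_num)) _)) ?_
      simp [hk, cubic_eq_monomial]
    have h2 := hlin _ h1
    have h3 : evol (hopfFlow h κ s) cubic =
        linM (burgersB h κ) s cubic + linFlow (burgersB h κ) s cubic := by
      rw [evol_congr (cubic_mem_upTo (μ := 2) (by norm_num))
        (fun j hj => hopfFlow_of_le h κ s hj), linM, sub_add_cancel]
    rw [map_sub, Derivation.map_smul, h3, linFlow_sub, linFlow_smul, smul_add] at h2
    linear_combination -h2

/-- Both sides are the coefficient of `ε^{k+1} ∂^{k+1}` in the symbol of `(p_{n+1} - p_{n-1}) /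
(2h)` on the first harmonic. The sine is split into exponentials and `(-i)^k` absorbs their
quarter-turn phases. -/
theorem dispersion_coeff {h : ℝ} (κ : ℝ) (k : ℕ) :
    (-Complex.I) ^ k * (burgersB h κ (k + 1) : ℂ) =
      ((1 / (2 * h) : ℝ) : ℂ) * ((1 / ((k + 1).factorial : ℂ)) *
        (Complex.exp (Complex.I * (κ * h : ℝ)) -
          (-1) ^ (k + 1) * Complex.exp (-(Complex.I * (κ * h : ℝ))))) := by
  set x : ℝ := κ * h with hx
  have h1 : Complex.exp (-((x : ℂ) + (k + 1 : ℕ) * (Real.pi / 2)) * Complex.I) =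
      Complex.exp (-(Complex.I * x)) * (-Complex.I) ^ (k + 1) := by
    have : (-Complex.I) ^ (k + 1) = Complex.exp ((k + 1 : ℕ) * (-Real.pi / 2 * Complex.I)) := by
      rw [Complex.exp_nat_mul, Complex.exp_neg_pi_div_two_mul_I]
    rw [this, ← Complex.exp_add]
    congr 1
    ring
  have h2 : Complex.exp (((x : ℂ) + (k + 1 : ℕ) * (Real.pi / 2)) * Complex.I) =
      Complex.exp (Complex.I * x) * Complex.I ^ (k + 1) := by
    have : Complex.I ^ (k + 1) = Complex.exp ((k + 1 : ℕ) * (Real.pi / 2 * Complex.I)) := by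
      rw [Complex.exp_nat_mul, Complex.exp_pi_div_two_mul_I]
    rw [this, ← Complex.exp_add]
    congr 1
    ring
  have h3 : (-Complex.I) ^ k * Complex.I ^ (k + 1) = Complex.I := by
    rw [pow_succ, ← mul_assoc, ← mul_pow]
    simp
  have h4 : (-Complex.I) ^ k * (-Complex.I) ^ (k + 1) = (-1) ^ (k + 1) * Complex.I := by
    rw [pow_succ, ← mul_assoc, ← mul_pow]
    simp [pow_succ]
  have h5 : (-Complex.I) ^ k * Complex.sin ((x : ℂ) + (k + 1 : ℕ) * (Real.pi / 2)) =
      (Complex.exp (Complex.I * x) - (-1) ^ (k + 1) * Complex.exp (-(Complex.I * x))) / 2 := by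
    rw [Complex.sin, h1, h2]
    linear_combination (Complex.exp (-(Complex.I * x)) * Complex.I / 2) * h4 -
      (Complex.exp (Complex.I * x) * Complex.I / 2) * h3 +
      ((-1) ^ (k + 1) * Complex.exp (-(Complex.I * x)) - Complex.exp (Complex.I * x)) / 2 *
        Complex.I_mul_I
  rw [burgersB, ← hx]
  push_cast at h5 ⊢
  rw [← mul_div_assoc, h5]
  field_simp

/-- The symbol of order `ε^0` fixes the frequency and the higher ones match the linear flows of the
amplitudes. The harmonic `-1` follows by reality and no others occur; vanishing at the orders 0 to 5
gives the factor `ε^6`. -/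
theorem timeD_potential (h κ : ℝ) :
    ∃ r, timeD (-(Real.sin (κ * h) / h)) (hopfFlow h κ) (potential (hopfAmp h (κ * h))) =
      ((1 / (2 * h) : ℝ) : ℂ) • (shift (κ * h) 1 (potential (hopfAmp h (κ * h))) -
        shift (κ * h) (-1) (potential (hopfAmp h (κ * h)))) + PowerSeries.X ^ 6 * r := by
  set x := κ * h with hx
  set ω := -(Real.sin (κ * h) / h) with hω
  set W := hopfAmp h x with hW
  set δ := timeD ω (hopfFlow h κ) (firstHarmonic W) - ((1 / (2 * h) : ℝ) : ℂ) •
    (shift x 1 (firstHarmonic W) - shift x (-1) (firstHarmonic W)) with hδ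
  have hbar : barSeries δ = δ := by
    rw [hδ, map_sub, barSeries_timeD, barSeries_smul, map_sub, barSeries_shift, barSeries_shift,
      barSeries_firstHarmonic, Complex.conj_ofReal]
  have hcf : ∀ n θ, cf δ n θ = (-(Complex.I * θ * ω)) • cf (firstHarmonic W) n θ +
      ∑ s ∈ Finset.Icc 1 n, evol (hopfFlow h κ s) (cf (firstHarmonic W) (n - s) θ) -
      ((1 / (2 * h) : ℝ) : ℂ) • (cf (shift x 1 (firstHarmonic W)) n θ -
        cf (shift x (-1) (firstHarmonic W)) n θ) := by
    intro n θ
    rw [hδ, cf_sub, cf_timeD, cf_smul, cf_sub]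
  have h1 : ∀ n ≤ 5, cf δ n 1 = 0 := by
    intro n hn
    rw [hcf, cf_shift, cf_shift, ← Finset.sum_sub_distrib, Finset.range_eq_Ico,
      Finset.sum_eq_sum_Ico_succ_bot (Nat.succ_pos n), smul_add, Finset.smul_sum]
    have hI : Finset.Icc 1 n = Finset.Ico (0 + 1) (n + 1) := by ext; simp
    rw [hI, add_sub_add_comm, ← Finset.sum_sub_distrib, Finset.sum_eq_zero, add_zero]
    · rw [Nat.sub_zero, dxPow_zero, ← sub_smul, smul_smul, ← sub_smul]
      have : -(Complex.I * ((1 : ℤ) : ℂ) * ω) - ((1 / (2 * h) : ℝ) : ℂ) *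
          ((((1 : ℤ) : ℂ) ^ 0 / (Nat.factorial 0 : ℂ)) *
            Complex.exp (Complex.I * ((1 : ℤ) : ℂ) * ((1 : ℤ) : ℂ) * x) -
          (((-1 : ℤ) : ℂ) ^ 0 / (Nat.factorial 0 : ℂ)) *
            Complex.exp (Complex.I * ((-1 : ℤ) : ℂ) * ((1 : ℤ) : ℂ) * x)) = 0 := by
        rw [hω, ← hx]
        push_cast
        rw [Complex.sin]
        simp only [mul_one, pow_zero, Nat.factorial_zero, Nat.cast_one, div_one, one_mul,
          neg_mul, mul_comm Complex.I]
        ring_nf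
        rw [Complex.I_sq]
        ring
      rw [this, zero_smul]
    · intro s hs
      obtain ⟨hs1, hs2⟩ := Finset.mem_Ico.mp hs
      rw [cf_firstHarmonic, if_pos rfl, evol_hopfAmp h κ (by omega) (by omega), sub_eq_zero,
        ← sub_smul, smul_smul, linFlow]
      obtain ⟨k, rfl⟩ := Nat.exists_eq_add_of_le' hs1
      rw [zero_add, Nat.add_sub_cancel, dispersion_coeff]
      congr 2
      push_cast
      simp only [one_pow, mul_one, mul_neg, neg_mul]
      rw [hx]
      push_cast
      ring
  have h2 : ∀ n ≤ 5, ∀ θ, cf δ n θ = 0 := by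
    intro n hn θ
    by_cases hθ : θ = 1
    · rw [hθ, h1 n hn]
    by_cases hθ' : θ = -1
    · rw [hθ', ← hbar, cf_barSeries, neg_neg, h1 n hn, map_zero]
    · have : ∀ k, cf (firstHarmonic W) k θ = 0 := fun k => by
        rw [cf_firstHarmonic, if_neg hθ, if_neg hθ']
      rw [hcf, cf_shift, cf_shift]
      simp [this]
  obtain ⟨r, hr⟩ : PowerSeries.X ^ 6 ∣ δ := by
    rw [PowerSeries.X_pow_dvd_iff]
    exact fun n hn => LaurentPolynomial.ext (h2 n (by omega))
  refine ⟨r, ?_⟩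
  rw [← hr, hδ, potential, map_add, map_add, map_add, timeD_one, map_one, map_one]
  ring_nf

/-! ### Expansions as formal series -/

theorem cf_harmonicSeries (c : ℕ → ℤ → DiffPoly) (n : ℕ) (θ : ℤ) :
    cf (harmonicSeries c) n θ = if |θ| ≤ n then c n θ else 0 := by
  rw [cf, harmonicSeries, PowerSeries.coeff_mk, AddMonoidAlgebra.coeff_sum, Finset.sum_apply']
  simp_rw [← LaurentPolynomial.single_eq_C_mul_T, AddMonoidAlgebra.coeff_single,
    Finsupp.single_apply]
  simp [abs_le]

/-- The right-hand side of the Burgers equation for a formal series. -/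
def burgersOp (h x : ℝ) (U : Series) : Series :=
  ((1 / (2 * h) : ℝ) : ℂ) •
    ((1 + (h : ℂ) • U) * (shift x 1 U - U) - (shift x (-1) U - U) *
      PowerSeries.invOfUnit (1 + (h : ℂ) • shift x (-1) U) 1)

namespace Expansion

variable (e : Expansion)

/-- The formal series `u_n`. -/
def series : Series := harmonicSeries e.amp

variable {e}

theorem cf_series (hs : ∀ (γ : ℕ) (θ : ℤ), (γ : ℤ) < |θ| → e.amp γ θ = 0) (n : ℕ) (θ : ℤ) :
    cf e.series n θ = e.amp n θ := by
  rw [series, cf_harmonicSeries]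
  split_ifs with h
  · rfl
  · exact (hs n θ (not_le.mp h)).symm

theorem shifted_eq (hs : ∀ (γ : ℕ) (θ : ℤ), (γ : ℤ) < |θ| → e.amp γ θ = 0) (h κ : ℝ) (σ : ℤ) :
    e.shifted h κ σ = shift (κ * h) σ e.series := by
  refine cf_ext fun n θ => ?_
  rw [shifted, cf_harmonicSeries, cf_shift]
  simp_rw [cf_series hs]
  split_ifs with hn
  · refine Finset.sum_congr rfl fun k _ => ?_
    push_cast
    rw [mul_assoc _ (κ : ℂ)]
  · refine (Finset.sum_eq_zero fun k _ => ?_).symm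
    rw [hs (n - k) θ (lt_of_le_of_lt (by exact_mod_cast Nat.sub_le n k) (not_le.mp hn)),
      dxPow_map_zero, smul_zero]

theorem timeDeriv_eq (hs : ∀ (γ : ℕ) (θ : ℤ), (γ : ℤ) < |θ| → e.amp γ θ = 0) :
    e.timeDeriv = timeD e.ω e.flow e.series := by
  refine cf_ext fun n θ => ?_
  rw [timeDeriv, cf_harmonicSeries, cf_timeD]
  simp_rw [cf_series hs]
  split_ifs with hn
  · rfl
  · rw [hs n θ (not_le.mp hn), smul_zero, zero_add]
    refine (Finset.sum_eq_zero fun k _ => ?_).symm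
    rw [hs (n - k) θ (lt_of_le_of_lt (by exact_mod_cast Nat.sub_le n k) (not_le.mp hn)), map_zero]

theorem burgersRHS_eq (hs : ∀ (γ : ℕ) (θ : ℤ), (γ : ℤ) < |θ| → e.amp γ θ = 0) (h κ : ℝ) :
    e.burgersRHS h κ = burgersOp h (κ * h) e.series := by
  rw [burgersRHS, burgersOp, shifted_eq hs, shifted_eq hs, shifted_eq hs, shift_zero]

end Expansion

theorem exp_ne_one {x : ℝ} (hx : Real.sin x ≠ 0) : Complex.exp (Complex.I * x) ≠ 1 := by
  intro h
  have := congrArg Complex.im h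
  rw [mul_comm, Complex.exp_ofReal_mul_I_im, Complex.one_im] at this
  exact hx this

theorem constantCoeff_burgers_unit (h x : ℝ) {U : Series} (hU : PowerSeries.constantCoeff U = 0) :
    PowerSeries.constantCoeff (1 + (h : ℂ) • shift x (-1) U) = 1 := by
  have h1 := constantCoeff_shift x (-1) (f := 1 + U) (by simp [hU])
  rw [map_add, map_one, map_add, map_one, add_eq_left] at h1
  rw [map_add, map_one, add_eq_left, Algebra.smul_def, map_mul, h1, mul_zero]

/-- The expansion obtained by the Hopf–Cole transformation. -/
def hopfExpansion (h κ : ℝ) : Expansion where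
  ω := -(Real.sin (κ * h) / h)
  amp n θ := cf (hopfCole h (κ * h) (hopfAmp h (κ * h))) n θ
  flow := hopfFlow h κ

theorem isGraded_hopfExpansion (h κ : ℝ) (n : ℕ) (θ : ℤ) :
    IsGraded ((hopfExpansion h κ).amp n θ) n θ :=
  isGraded_cf_hopfCole h (κ * h) n θ

theorem hopfExpansion_amp_zero (h κ : ℝ) (θ : ℤ) : (hopfExpansion h κ).amp 0 θ = 0 :=
  cf_hopfCole_zero h (κ * h) (hopfAmp_zero _ _) θ

theorem forcing_mem_P (h κ : ℝ) (s : ℕ) (j : ℕ+) {μ : ℕ} (hμ : 1 ≤ μ) :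
    forcing h κ s j ∈ P (s + j) μ := by
  rw [forcing]
  split_ifs with hj
  · subst hj
    exact Submodule.smul_mem _ _ (linM_cubic_mem_P _ _ hμ)
  · exact zero_mem _

/-- The nonlinear flow occurs only at `j = 3`, where `s, r ≥ 2` within order 5 forces `s = r = 2`.
The case of index 1 is transport, which commutes with everything. -/
theorem hopfFlow_comm (h κ : ℝ) {s r : ℕ} {j : ℕ+} (hs : 1 ≤ s) (hr : 1 ≤ r) (hsj : s + j ≤ 5)
    (hrj : r + j ≤ 5) :
    evol (hopfFlow h κ s) (hopfFlow h κ r j) = evol (hopfFlow h κ r) (hopfFlow h κ s j) := by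
  have h1 : ∀ r, evol (hopfFlow h κ 1) (hopfFlow h κ r j) =
      evol (hopfFlow h κ r) (hopfFlow h κ 1 j) := by
    intro r
    rw [evol_hopfFlow_one, hopfFlow_one, ← linFlow_one, evol_linFlow, evol_u]
  by_cases hj : j = 3
  · have hj' : (j : ℕ) = 3 := by rw [hj]; rfl
    by_cases hs1 : s = 1
    · rw [hs1, h1]
    by_cases hr1 : r = 1
    · rw [hr1, h1]
    obtain rfl : s = r := by omega
    rfl
  · rw [hopfFlow_of_ne h κ s hj, hopfFlow_of_ne h κ r hj, evol_linFlow, evol_linFlow, evol_u,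
      evol_u, hopfFlow_of_ne h κ s hj, hopfFlow_of_ne h κ r hj, linFlow_comm]

theorem burgersB_one (h κ : ℝ) : burgersB h κ 1 = Real.cos (κ * h) / h := by
  simp [burgersB, Real.sin_add_pi_div_two]

theorem burgersB_two (h κ : ℝ) : burgersB h κ 2 = -(Real.sin (κ * h) / (2 * h)) := by
  have : κ * h + ((2 : ℕ) : ℝ) * (Real.pi / 2) = κ * h + Real.pi := by push_cast; ring
  rw [burgersB, this, Real.sin_add_pi]
  simp [neg_div, mul_comm]

theorem isBurgersExpansion_hopfExpansion {h κ : ℝ} (hh : h ≠ 0) (hκ : Real.sin (κ * h) ≠ 0) :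
    (hopfExpansion h κ).IsBurgersExpansion h κ 5 := by
  have hsupp : ∀ (γ : ℕ) (θ : ℤ), (γ : ℤ) < |θ| → (hopfExpansion h κ).amp γ θ = 0 :=
    fun γ θ hθ => (isGraded_hopfExpansion h κ γ θ).eq_zero hθ
  have hser : (hopfExpansion h κ).series = hopfCole h (κ * h) (hopfAmp h (κ * h)) :=
    cf_ext fun n θ => Expansion.cf_series hsupp n θ
  refine ⟨hopfExpansion_amp_zero h κ, hsupp,
    fun j => cf_hopfCole_one hh (exp_ne_one hκ) j, fun γ θ => ?_, fun γ θ => ?_,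
    fun γ hγ => ?_, ⟨_, hopfFlow_one h κ⟩, fun s j _ _ => ?_,
    fun s r j hs hr hsj hrj => hopfFlow_comm h κ hs hr hsj hrj⟩
  · have h1 := cf_barSeries (hopfCole h (κ * h) (hopfAmp h (κ * h))) γ (-θ)
    rw [barSeries_hopfCole _ _ (hopfAmp_zero _ _), neg_neg] at h1
    exact h1
  · rcases eq_or_ne γ 0 with rfl | hγ
    · rw [hopfExpansion_amp_zero, map_zero]
    · exact (isGraded_hopfExpansion h κ γ θ).constantCoeff hγ
  · rw [Expansion.timeDeriv_eq hsupp, Expansion.burgersRHS_eq hsupp, hser]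
    obtain ⟨r, hr⟩ := timeD_potential h κ
    have hU : PowerSeries.constantCoeff (hopfCole h (κ * h) (hopfAmp h (κ * h))) = 0 :=
      LaurentPolynomial.ext fun θ => by
        rw [← PowerSeries.coeff_zero_eq_constantCoeff_apply]
        exact cf_hopfCole_zero h (κ * h) (hopfAmp_zero _ _) θ
    obtain ⟨r', hr'⟩ := timeD_hopfCole hh (κ * h) _ (hopfFlow h κ) (hopfAmp_zero _ _) hr
      (PowerSeries.mul_invOfUnit _ 1
        (by rw [constantCoeff_burgers_unit h (κ * h) hU, Units.val_one]))
    change PowerSeries.coeff γ (timeD _ (hopfFlow h κ) _) = _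
    rw [show (hopfExpansion h κ).ω = -(Real.sin (κ * h) / h) from rfl, hr', map_add, burgersOp,
      PowerSeries.coeff_X_pow_mul', if_neg (by omega), add_zero]
  · refine ⟨(-Complex.I) ^ (s - 1) * (burgersB h κ s : ℂ), ?_⟩
    have : (hopfExpansion h κ).flow s j -
        ((-Complex.I) ^ (s - 1) * (burgersB h κ s : ℂ)) • dxPow s (u j) = forcing h κ s j := by
      change hopfFlow h κ s j - linFlow (burgersB h κ) s (u j) = _
      rw [hopfFlow, add_sub_cancel_left]
    rw [this]
    exact forcing_mem_P h κ s j j.pos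

/-! ### Uniqueness of the expansion -/

theorem cf_shift_one (x : ℝ) (σ : ℤ) (f : Series) (θ : ℤ) :
    cf (shift x σ f) 1 θ = Complex.exp (Complex.I * σ * θ * x) •
      (cf f 1 θ + (σ : ℂ) • dx (cf f 0 θ)) := by
  rw [cf_shift, Finset.sum_range_succ, Finset.sum_range_one]
  simp [smul_smul, mul_comm]

theorem cf_shift_zero (x : ℝ) (σ : ℤ) (f : Series) (θ : ℤ) :
    cf (shift x σ f) 0 θ = Complex.exp (Complex.I * σ * θ * x) • cf f 0 θ := by
  rw [cf_shift, Finset.sum_range_one]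
  simp

theorem constantCoeff_eq_of_cf {f g : Series} (h : ∀ θ, cf f 0 θ = cf g 0 θ) :
    PowerSeries.constantCoeff f = PowerSeries.constantCoeff g := by
  rw [← PowerSeries.coeff_zero_eq_constantCoeff_apply,
    ← PowerSeries.coeff_zero_eq_constantCoeff_apply]
  exact LaurentPolynomial.ext h

/-- The first variation of the right-hand side of the Burgers equation. -/
theorem cf_burgersOp_sub (h x : ℝ) {U U' d : Series} (hU : PowerSeries.constantCoeff U = 0)
    (hU' : PowerSeries.constantCoeff U' = 0) {m : ℕ} (hd : U - U' = PowerSeries.X ^ m * d)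
    (hd0 : ∀ θ, θ ≠ 0 → cf d 0 θ = 0) (θ : ℤ) :
    cf (burgersOp h x U - burgersOp h x U') (m + 1) θ = ((1 / (2 * h) : ℝ) : ℂ) •
      ((Complex.exp (Complex.I * θ * x) - Complex.exp (-(Complex.I * θ * x))) • cf d 1 θ +
       (Complex.exp (Complex.I * θ * x) + Complex.exp (-(Complex.I * θ * x))) • dx (cf d 0 θ) +
       ((h : ℂ) * (Complex.exp (Complex.I * θ * x) + Complex.exp (-(Complex.I * θ * x)) - 2)) •
        (cf d 0 0 * cf U' 1 θ)) := by
  have hq : (1 + (h : ℂ) • shift x (-1) U) *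
      PowerSeries.invOfUnit (1 + (h : ℂ) • shift x (-1) U) 1 = 1 :=
    PowerSeries.mul_invOfUnit _ 1 (by rw [constantCoeff_burgers_unit h x hU, Units.val_one])
  have hq' : (1 + (h : ℂ) • shift x (-1) U') *
      PowerSeries.invOfUnit (1 + (h : ℂ) • shift x (-1) U') 1 = 1 :=
    PowerSeries.mul_invOfUnit _ 1 (by rw [constantCoeff_burgers_unit h x hU', Units.val_one])
  have hc := congrArg PowerSeries.constantCoeff hq
  have hc' := congrArg PowerSeries.constantCoeff hq'
  rw [map_mul, constantCoeff_burgers_unit h x hU, one_mul, map_one] at hc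
  rw [map_mul, constantCoeff_burgers_unit h x hU', one_mul, map_one] at hc'
  rw [burgersOp, burgersOp]
  set q := PowerSeries.invOfUnit (1 + (h : ℂ) • shift x (-1) U) 1
  set q' := PowerSeries.invOfUnit (1 + (h : ℂ) • shift x (-1) U') 1
  have hS : ∀ σ, shift x σ U = shift x σ U' + PowerSeries.X ^ m * shift x σ d := by
    intro σ
    rw [← shift_X_pow_mul, ← hd, map_sub]; ring
  -- The leading part of `d` is a mean value, which shifts leave unchanged.
  have hSd : ∀ σ, PowerSeries.constantCoeff (shift x σ d) = PowerSeries.constantCoeff d := by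
    refine fun σ => constantCoeff_eq_of_cf fun θ => ?_
    rw [cf_shift_zero]
    by_cases hθ : θ = 0
    · simp [hθ]
    · rw [hd0 θ hθ, smul_zero]
  have hU'0 : ∀ θ, cf U' 0 θ = 0 := fun θ => by
    rw [cf, PowerSeries.coeff_zero_eq_constantCoeff_apply, hU']; rfl
  have hSU : ∀ σ, PowerSeries.constantCoeff (shift x σ U') = 0 := fun σ => by
    rw [← map_zero PowerSeries.constantCoeff]
    refine constantCoeff_eq_of_cf fun θ => ?_
    rw [cf_shift_zero, hU'0, smul_zero, cf_zero]
  -- An exact difference formula. The two inverses are combined through `q - q' = -h q q' ε^m S⁻¹d`,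
  -- where `S⁻¹` denotes the backward shift.
  have key : (1 + (h : ℂ) • U) * (shift x 1 U - U) - (shift x (-1) U - U) * q -
      ((1 + (h : ℂ) • U') * (shift x 1 U' - U') - (shift x (-1) U' - U') * q') =
      PowerSeries.X ^ m * ((1 + (h : ℂ) • U) * (shift x 1 d - d) +
        (h : ℂ) • (d * (shift x 1 U' - U')) - (shift x (-1) d - d) * q +
        (h : ℂ) • ((shift x (-1) U' - U') * (q * q' * shift x (-1) d))) := by
    have e1 : U = U' + PowerSeries.X ^ m * d := by rw [← hd]; ring
    simp only [Algebra.smul_def] at hq hq' ⊢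
    have e3 := hS 1
    have e4 := hS (-1)
    set S := shift x 1 U
    set S' := shift x (-1) U
    linear_combination (1 + algebraMap ℂ Series h * U) * e3
      - (shift x (-1) U' - U') * q' * hq + (shift x (-1) U' - U') * q * hq'
      + (algebraMap ℂ Series h * (shift x (-1) U' - U') * q * q' - q) * e4
      + (q + algebraMap ℂ Series h * (shift x 1 U' - U') - 1 - algebraMap ℂ Series h * U) * e1
  have hcoef : PowerSeries.coeff 1 ((1 + (h : ℂ) • U) * (shift x 1 d - d) +
        (h : ℂ) • (d * (shift x 1 U' - U')) - (shift x (-1) d - d) * q +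
        (h : ℂ) • ((shift x (-1) U' - U') * (q * q' * shift x (-1) d))) =
      PowerSeries.coeff 1 (shift x 1 d) - PowerSeries.coeff 1 (shift x (-1) d) +
        (h : ℂ) • (PowerSeries.constantCoeff d * (PowerSeries.coeff 1 (shift x 1 U') +
          PowerSeries.coeff 1 (shift x (-1) U') - (2 : ℂ) • PowerSeries.coeff 1 U')) := by
    have hs : ∀ f : Series, PowerSeries.coeff 1 ((h : ℂ) • f) = (h : ℂ) • PowerSeries.coeff 1 f :=
      fun f => rfl
    have hs0 : ∀ f : Series, PowerSeries.constantCoeff ((h : ℂ) • f) =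
      (h : ℂ) • PowerSeries.constantCoeff f := fun f => rfl
    simp only [map_add, map_sub, hs, hs0, PowerSeries.coeff_one_mul, hSd, hSU, hU, hU', hc, hc',
      map_one, map_mul, smul_zero, sub_self, two_smul]
    simp only [Algebra.smul_def]
    ring
  rw [← smul_sub, cf_smul, key, cf, add_comm m 1, PowerSeries.coeff_X_pow_mul, hcoef]
  congr 1
  simp only [AddMonoidAlgebra.coeff_add, AddMonoidAlgebra.coeff_sub, AddMonoidAlgebra.coeff_smul,
    Finsupp.add_apply, Finsupp.sub_apply, Finsupp.smul_apply]
  have hconst : PowerSeries.constantCoeff d = LaurentPolynomial.C (cf d 0 0) := by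
    refine LaurentPolynomial.ext fun a => ?_
    rw [LaurentPolynomial.C_apply, ← PowerSeries.coeff_zero_eq_constantCoeff_apply]
    split_ifs with ha
    · rw [ha]; rfl
    · exact hd0 a ha
  have hC : ∀ (p : DiffPoly) (y : DiffPoly[T;T⁻¹]),
      (LaurentPolynomial.C p * y).coeff θ = p * y.coeff θ := by
    intro p y
    rw [← LaurentPolynomial.smul_eq_C_mul]
    simp
  rw [hconst, hC]
  simp only [AddMonoidAlgebra.coeff_add, AddMonoidAlgebra.coeff_sub, AddMonoidAlgebra.coeff_smul,
    Finsupp.add_apply, Finsupp.sub_apply, Finsupp.smul_apply]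
  change cf (shift x 1 d) 1 θ - cf (shift x (-1) d) 1 θ + (h : ℂ) • (cf d 0 0 *
    (cf (shift x 1 U') 1 θ + cf (shift x (-1) U') 1 θ - (2 : ℂ) • cf U' 1 θ)) = _
  rw [cf_shift_one, cf_shift_one, cf_shift_one, cf_shift_one, hU'0]
  have hexp : Complex.exp (Complex.I * ((-1 : ℤ) : ℂ) * θ * x) =
      Complex.exp (-(Complex.I * θ * x)) := by push_cast; ring_nf
  have hexp' : Complex.exp (Complex.I * ((1 : ℤ) : ℂ) * θ * x) =
      Complex.exp (Complex.I * θ * x) := by push_cast; ring_nf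
  rw [hexp, hexp']
  simp only [map_zero, smul_zero, add_zero, Int.cast_one, Int.cast_neg, MvPolynomial.smul_eq_C_mul,
    map_add, map_sub, map_mul, map_neg, map_one, map_ofNat]
  ring

/-- Induction with the addition formula. Strictness comes from `|cos x| < 1`, while the weak bound
starts the induction. -/
theorem abs_sin_nat_mul_lt {x : ℝ} (hx : Real.sin x ≠ 0) (n : ℕ) :
    |Real.sin ((n + 1 : ℕ) * x)| ≤ (n + 1 : ℕ) * |Real.sin x| ∧
      (1 ≤ n → |Real.sin ((n + 1 : ℕ) * x)| < (n + 1 : ℕ) * |Real.sin x|) := by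
  have hpos : 0 < |Real.sin x| := abs_pos.mpr hx
  have hcos : |Real.cos x| < 1 := by
    rw [← sq_lt_one_iff_abs_lt_one]
    have := Real.sin_sq_add_cos_sq x
    have : 0 < Real.sin x ^ 2 := by positivity
    linarith
  induction n with
  | zero => simp
  | succ n ih =>
    have h1 : |Real.sin ((n + 1 + 1 : ℕ) * x)| < (n + 1 + 1 : ℕ) * |Real.sin x| := by
      have h2 : ((n + 1 + 1 : ℕ) : ℝ) * x = (n + 1 : ℕ) * x + x := by push_cast; ring
      rw [h2, Real.sin_add]
      calc |Real.sin ((n + 1 : ℕ) * x) * Real.cos x + Real.cos ((n + 1 : ℕ) * x) * Real.sin x|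
          ≤ |Real.sin ((n + 1 : ℕ) * x)| * |Real.cos x| +
            |Real.cos ((n + 1 : ℕ) * x)| * |Real.sin x| := by
            rw [← abs_mul, ← abs_mul]
            exact abs_add_le _ _
        _ ≤ ((n + 1 : ℕ) * |Real.sin x|) * |Real.cos x| + 1 * |Real.sin x| := by
            gcongr
            · exact ih.1
            · exact Real.abs_cos_le_one _
        _ < ((n + 1 : ℕ) * |Real.sin x|) * 1 + 1 * |Real.sin x| := by
            gcongr
        _ = (n + 1 + 1 : ℕ) * |Real.sin x| := by push_cast; ring
    exact ⟨h1.le, fun _ => h1⟩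

/-- There are no resonant harmonics apart from the first one. -/
theorem sin_int_mul_ne {x : ℝ} (hx : Real.sin x ≠ 0) {θ : ℤ} (hθ : 2 ≤ θ) :
    Real.sin (θ * x) ≠ θ * Real.sin x := by
  obtain ⟨n, rfl⟩ : ∃ n : ℕ, θ = (n + 1 + 1 : ℕ) := ⟨(θ - 2).toNat, by omega⟩
  intro h
  have h1 := (abs_sin_nat_mul_lt hx (n + 1)).2 (by omega)
  rw [Int.cast_natCast] at h
  rw [h, abs_mul, Nat.abs_cast] at h1
  exact lt_irrefl _ h1

namespace Expansion

/-- Two expansions agree up to order `ε^m`, with the exception of the mean value of order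
`ε^m`. -/
structure AgreesUpTo (e f : Expansion) (m : ℕ) : Prop where
  amp_lt : ∀ n < m, ∀ θ, e.amp n θ = f.amp n θ
  amp_eq : ∀ θ, θ ≠ 0 → e.amp m θ = f.amp m θ
  flow_eq : ∀ (s : ℕ) (j : ℕ+), 1 ≤ s → s + j ≤ m → e.flow s j = f.flow s j

end Expansion

section Uniqueness

open Expansion

variable {e f : Expansion} {h κ : ℝ}

theorem Expansion.IsBurgersExpansion.constantCoeff_series {N : ℕ}
    (he : e.IsBurgersExpansion h κ N) : PowerSeries.constantCoeff e.series = 0 := by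
  rw [← map_zero PowerSeries.constantCoeff]
  exact constantCoeff_eq_of_cf fun θ => by
    rw [cf_series he.amp_support, he.amp_zero, cf_zero]

theorem Expansion.IsBurgersExpansion.cf_equation {N : ℕ} (he : e.IsBurgersExpansion h κ N) {n : ℕ}
    (hn : n ≤ N) (θ : ℤ) :
    (-(Complex.I * θ * e.ω)) • e.amp n θ +
      ∑ s ∈ Finset.Icc 1 n, evol (e.flow s) (e.amp (n - s) θ) =
      cf (burgersOp h (κ * h) e.series) n θ := by
  have h1 := congrArg (fun y : DiffPoly[T;T⁻¹] => y.coeff θ) (he.equation n hn)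
  rw [timeDeriv_eq he.amp_support, burgersRHS_eq he.amp_support] at h1
  refine Eq.trans ?_ h1
  change _ = cf (timeD e.ω e.flow e.series) n θ
  rw [cf_timeD]
  simp_rw [cf_series he.amp_support]

/-- Two expansions that differ at order `ε^m` only in their mean value differ at the next order by
linear terms and one product of that mean with the first-order amplitude. -/
theorem difference_eq {N : ℕ} (he : e.IsBurgersExpansion h κ N) (hf : f.IsBurgersExpansion h κ N)
    {m : ℕ} (hm : m + 1 ≤ N) (hlt : ∀ n < m, ∀ θ, e.amp n θ = f.amp n θ)
    (heq : ∀ θ, θ ≠ 0 → e.amp m θ = f.amp m θ) (θ : ℤ) :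
    ((-(Complex.I * θ * e.ω)) • e.amp (m + 1) θ +
      ∑ s ∈ Finset.Icc 1 (m + 1), evol (e.flow s) (e.amp (m + 1 - s) θ)) -
    ((-(Complex.I * θ * f.ω)) • f.amp (m + 1) θ +
      ∑ s ∈ Finset.Icc 1 (m + 1), evol (f.flow s) (f.amp (m + 1 - s) θ)) =
    ((1 / (2 * h) : ℝ) : ℂ) •
      ((Complex.exp (Complex.I * θ * (κ * h : ℝ)) - Complex.exp (-(Complex.I * θ * (κ * h : ℝ)))) •
        (e.amp (m + 1) θ - f.amp (m + 1) θ) +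
       (Complex.exp (Complex.I * θ * (κ * h : ℝ)) + Complex.exp (-(Complex.I * θ * (κ * h : ℝ)))) •
        dx (e.amp m θ - f.amp m θ) +
       ((h : ℂ) * (Complex.exp (Complex.I * θ * (κ * h : ℝ)) +
          Complex.exp (-(Complex.I * θ * (κ * h : ℝ))) - 2)) •
        ((e.amp m 0 - f.amp m 0) * f.amp 1 θ)) := by
  obtain ⟨d, hd⟩ : PowerSeries.X ^ m ∣ e.series - f.series := by
    rw [PowerSeries.X_pow_dvd_iff]
    intro n hn
    refine LaurentPolynomial.ext fun θ => ?_
    change cf (e.series - f.series) n θ = 0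
    rw [cf_sub, cf_series he.amp_support, cf_series hf.amp_support, hlt n hn, sub_self]
  have hcd : ∀ k θ, cf d k θ = e.amp (m + k) θ - f.amp (m + k) θ := by
    intro k θ
    rw [← cf_series he.amp_support, ← cf_series hf.amp_support, ← cf_sub, hd, cf, cf, add_comm m k,
      PowerSeries.coeff_X_pow_mul]
  rw [he.cf_equation hm, hf.cf_equation hm, ← cf_sub, cf_burgersOp_sub h (κ * h)
    he.constantCoeff_series hf.constantCoeff_series hd (fun θ hθ => by
      rw [hcd, add_zero, heq θ hθ, sub_self]), hcd, hcd, hcd, cf_series hf.amp_support, add_zero]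

/-! ### Frequency and group velocity. -/

theorem u_ne_zero (j : ℕ+) : u j ≠ 0 := MvPolynomial.X_ne_zero _

theorem omega_eq {N : ℕ} (he : e.IsBurgersExpansion h κ N) (hf : f.IsBurgersExpansion h κ N)
    (hN : 1 ≤ N) : e.ω = f.ω := by
  have h1 := difference_eq he hf (m := 0) hN (by simp)
    (fun θ _ => by rw [he.amp_zero, hf.amp_zero]) 1
  have he1 : e.amp 1 1 = u 1 := he.amp_one 1
  have hf1 : f.amp 1 1 = u 1 := hf.amp_one 1
  simp only [zero_add, he1, hf1, Finset.Icc_self, Finset.sum_singleton, Nat.sub_self, he.amp_zero,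
    hf.amp_zero, map_zero, add_zero, sub_self, smul_zero, zero_mul] at h1
  rw [← sub_smul, smul_eq_zero, or_iff_left (u_ne_zero 1)] at h1
  have h2 : Complex.I * ((e.ω : ℂ) - f.ω) = 0 := by
    push_cast at h1
    linear_combination -h1
  have h3 := (mul_eq_zero.mp h2).resolve_left Complex.I_ne_zero
  exact_mod_cast sub_eq_zero.mp h3

theorem amp_one_eq {N : ℕ} (he : e.IsBurgersExpansion h κ N) (hf : f.IsBurgersExpansion h κ N)
    {θ : ℤ} (hθ : θ ≠ 0) : e.amp 1 θ = f.amp 1 θ := by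
  have he1 : e.amp 1 1 = u 1 := he.amp_one 1
  have hf1 : f.amp 1 1 = u 1 := hf.amp_one 1
  by_cases h1 : θ = 1
  · rw [h1, he1, hf1]
  by_cases h2 : θ = -1
  · rw [h2, he.amp_neg, hf.amp_neg, he1, hf1]
  · have h3 : ((1 : ℕ) : ℤ) < |θ| := by
      push_cast
      rw [lt_abs]
      omega
    rw [he.amp_support 1 θ h3, hf.amp_support 1 θ h3]

/-- The first harmonic at order `ε²` fixes the coefficient of `∂u(1)`. Since one constant serves all
`j`, this single order determines the whole `t_1`-flow. -/
theorem flow_one_eq {N : ℕ} (he : e.IsBurgersExpansion h κ N) (hf : f.IsBurgersExpansion h κ N)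
    (hN : 2 ≤ N) (j : ℕ+) : e.flow 1 j = f.flow 1 j := by
  obtain ⟨c, hc⟩ := he.flow_one
  obtain ⟨c', hc'⟩ := hf.flow_one
  have h1 := difference_eq he hf (m := 1) hN
    (fun n hn θ => by rw [Nat.lt_one_iff.mp hn, he.amp_zero, hf.amp_zero])
    (fun θ hθ => amp_one_eq he hf hθ) 1
  have he1 : e.amp 1 1 = u 1 := he.amp_one 1
  have hf1 : f.amp 1 1 = u 1 := hf.amp_one 1
  have he2 : e.amp 2 1 = u 2 := he.amp_one 2
  have hf2 : f.amp 2 1 = u 2 := hf.amp_one 2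
  have hI : Finset.Icc 1 (1 + 1) = {1, 2} := rfl
  simp only [hI, Finset.sum_pair (show 1 ≠ 2 by norm_num), Nat.reduceAdd, Nat.reduceSub, he1, hf1,
    he2, hf2, he.amp_zero, hf.amp_zero, map_zero, add_zero, sub_self, smul_zero, zero_add, evol_u,
    omega_eq he hf (by omega), add_sub_add_left_eq_sub, hc, hc', ← sub_smul] at h1
  -- The mean of order `ε` is still unknown here, but it enters multiplied by `u(1)` and so cannot
  -- contribute to the monomial `∂u(1)`.
  have h2 := congrArg (MvPolynomial.coeff (Finsupp.single ((1, 1, false) : Jet) 1)) h1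
  have hsupp : ((1, 0, false) : Jet) ∉
      (Finsupp.single ((1, 1, false) : Jet) 1 : Jet →₀ ℕ).support := by
    simp
  rw [u, dx_X, MvPolynomial.coeff_smul, MvPolynomial.coeff_smul, MvPolynomial.coeff_smul,
    MvPolynomial.coeff_mul_X', if_neg hsupp, MvPolynomial.coeff_X, smul_zero, smul_zero,
    smul_eq_mul, if_pos rfl, mul_one] at h2
  rw [hc, hc', sub_eq_zero.mp h2]

/-! ### Mean values and higher harmonics. -/

theorem exp_sub_exp_neg (y : ℝ) :
    Complex.exp (Complex.I * y) - Complex.exp (-(Complex.I * y)) = 2 * Complex.I * Real.sin y := by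
  rw [Complex.ofReal_sin, Complex.sin, mul_comm Complex.I, neg_mul]
  linear_combination (Complex.exp (y * Complex.I) - Complex.exp (-(y * Complex.I))) *
    Complex.I_mul_I

/-- The mean value of order `ε^m`. -/
theorem amp_mean_eq (hh : h ≠ 0) (hκ : Real.sin (κ * h) ≠ 0) (he : e.IsBurgersExpansion h κ 5)
    {m : ℕ} (hm : m + 1 ≤ 5) (hag : e.AgreesUpTo (hopfExpansion h κ) m) :
    e.amp m 0 = (hopfExpansion h κ).amp m 0 := by
  have hf := isBurgersExpansion_hopfExpansion hh hκ
  set f := hopfExpansion h κ with hf_def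
  rcases Nat.eq_zero_or_pos m with rfl | hm0
  · rw [he.amp_zero, hf.amp_zero]
  have hc : (h : ℂ) ≠ 0 := by exact_mod_cast hh
  have h1 := difference_eq he hf hm hag.amp_lt hag.amp_eq 0
  have hflow1 : e.flow 1 = fun j => (burgersB h κ 1 : ℂ) • dx (u j) := by
    ext1 j
    rw [flow_one_eq he hf (by norm_num)]
    exact hopfFlow_one h κ j
  have hflow1' : f.flow 1 = fun j => (burgersB h κ 1 : ℂ) • dx (u j) :=
    funext (hopfFlow_one h κ)
  -- The mean of order `m + 1 - s` involves only `u(j)` with `s + j ≤ m`, whose flows already agree.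
  -- The unknown mean of order `m` enters through `s = 1` alone.
  have hsum : ∑ s ∈ Finset.Icc 1 (m + 1), evol (e.flow s) (e.amp (m + 1 - s) 0) -
      ∑ s ∈ Finset.Icc 1 (m + 1), evol (f.flow s) (f.amp (m + 1 - s) 0) =
      (burgersB h κ 1 : ℂ) • dx (e.amp m 0 - f.amp m 0) := by
    rw [← Finset.sum_sub_distrib, Finset.sum_eq_single 1]
    · rw [hflow1, hflow1', Nat.add_sub_cancel, evol_smul_dx (Complex.conj_ofReal _),
        evol_smul_dx (Complex.conj_ofReal _), map_sub, smul_sub]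
    · intro s hs hs1
      obtain ⟨hs2, hs3⟩ := Finset.mem_Icc.mp hs
      rw [hag.amp_lt (m + 1 - s) (by omega), sub_eq_zero]
      refine evol_congr ((isGraded_hopfExpansion h κ _ 0).mem_upTo_pred (by norm_num)
        (by norm_num)) fun j hj => hag.flow_eq s j hs2 ?_
      have := j.pos
      omega
    · simp
  simp only [Int.cast_zero, mul_zero, zero_mul, neg_zero, zero_smul, zero_add, hsum,
    Complex.exp_zero, sub_self, one_add_one_eq_two, add_zero, smul_smul] at h1
  rw [← sub_eq_zero, ← sub_smul, smul_eq_zero] at h1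
  rw [← sub_eq_zero]
  -- The factor in front is `(cos κh - 1) / h`, nonzero because `sin κh ≠ 0`; decay then excludes a
  -- constant of integration.
  refine eq_zero_of_dx_eq_zero (h1.resolve_left fun h2 => ?_)
    (by rw [map_sub, he.amp_decay, hf.amp_decay, sub_self])
  have h3 : Real.cos (κ * h) = 1 := by
    rw [burgersB_one, sub_eq_zero] at h2
    have h4 : Real.cos (κ * h) / h = 1 / (2 * h) * 2 := by exact_mod_cast h2
    field_simp at h4
    exact h4
  have h5 := Real.sin_sq_add_cos_sq (κ * h)
  rw [h3] at h5
  exact hκ (pow_eq_zero_iff (two_ne_zero)|>.mp (by linarith))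

/-- The higher harmonics of order `ε^(m+1)`. -/
theorem amp_higher_eq (hh : h ≠ 0) (hκ : Real.sin (κ * h) ≠ 0) (he : e.IsBurgersExpansion h κ 5)
    {m : ℕ} (hm : m + 1 ≤ 5) (hag : e.AgreesUpTo (hopfExpansion h κ) m) {θ : ℤ} (hθ : 2 ≤ θ) :
    e.amp (m + 1) θ = (hopfExpansion h κ).amp (m + 1) θ := by
  have hf := isBurgersExpansion_hopfExpansion hh hκ
  have hmean := amp_mean_eq hh hκ he hm hag
  have hω := omega_eq he hf (by norm_num)
  have hωf : (hopfExpansion h κ).ω = -(Real.sin (κ * h) / h) := rfl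
  set f := hopfExpansion h κ with hf_def
  have hc : (h : ℂ) ≠ 0 := by exact_mod_cast hh
  have h1 := difference_eq he hf hm hag.amp_lt hag.amp_eq θ
  have hsum : ∑ s ∈ Finset.Icc 1 (m + 1), evol (e.flow s) (e.amp (m + 1 - s) θ) =
      ∑ s ∈ Finset.Icc 1 (m + 1), evol (f.flow s) (f.amp (m + 1 - s) θ) := by
    refine Finset.sum_congr rfl fun s hs => ?_
    obtain ⟨hs2, hs3⟩ := Finset.mem_Icc.mp hs
    have h2 : e.amp (m + 1 - s) θ = f.amp (m + 1 - s) θ := by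
      rcases eq_or_ne s 1 with rfl | hs1
      · exact hag.amp_eq θ (by omega)
      · exact hag.amp_lt _ (by omega) θ
    rw [h2]
    refine evol_congr ((isGraded_hopfExpansion h κ _ θ).mem_upTo_pred (by omega)
        (by omega)) fun j hj => ?_
    have := j.pos
    exact hag.flow_eq s j hs2 (by omega)
  have hexp := exp_sub_exp_neg (θ * (κ * h))
  have harg : Complex.I * ((θ * (κ * h) : ℝ) : ℂ) = Complex.I * θ * (κ * h : ℝ) := by
    push_cast; ring
  rw [harg] at hexp
  rw [hsum, hω, hmean, hag.amp_eq θ (by omega), sub_self, sub_self, map_zero, zero_mul, smul_zero,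
    smul_zero, add_zero, add_zero, add_sub_add_right_eq_sub, ← smul_sub, hexp, smul_smul,
    ← sub_eq_zero, ← sub_smul, smul_eq_zero] at h1
  -- The difference is multiplied by `(i/h) (θ sin κh - sin θκh)`, which would vanish only at a
  -- resonance.
  refine sub_eq_zero.mp (h1.resolve_left fun h2 => sin_int_mul_ne hκ hθ ?_)
  have h3 : Complex.I / h * ((θ * Real.sin (κ * h) - Real.sin (θ * (κ * h)) : ℝ) : ℂ) = 0 := by
    rw [← h2, hωf]
    push_cast
    field_simp
  have h4 := (mul_eq_zero.mp h3).resolve_left (div_ne_zero Complex.I_ne_zero hc)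
  have h5 : (θ : ℝ) * Real.sin (κ * h) - Real.sin (θ * (κ * h)) = 0 := by exact_mod_cast h4
  linarith

end Uniqueness

section Uniqueness

open Expansion

variable {e f : Expansion} {h κ : ℝ}

/-! ### Recovery of the slow flows from the first harmonic. -/

theorem amp_first_eq {N : ℕ} (he : e.IsBurgersExpansion h κ N) (m : ℕ) :
    e.amp (m + 1) 1 = u m.succPNat :=
  he.amp_one m.succPNat

/-- Once the means of order `m` agree, the first variation vanishes in the first harmonic. What
remains are the discrepancies of the flows with `s + j = m + 1`, constrained only in total. -/
theorem sum_flow_eq (hh : h ≠ 0) (hκ : Real.sin (κ * h) ≠ 0) (he : e.IsBurgersExpansion h κ 5)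
    {m : ℕ} (hm : m + 1 ≤ 5) (hag : e.AgreesUpTo (hopfExpansion h κ) m) :
    ∑ s ∈ Finset.Icc 1 m, (e.flow s (m - s).succPNat - hopfFlow h κ s (m - s).succPNat) = 0 := by
  have hf := isBurgersExpansion_hopfExpansion hh hκ
  have hmean := amp_mean_eq hh hκ he hm hag
  have hω := omega_eq he hf (by norm_num)
  have h1 := difference_eq he hf hm hag.amp_lt hag.amp_eq 1
  have h2 : ∀ {e : Expansion}, e.IsBurgersExpansion h κ 5 →
      ∑ s ∈ Finset.Icc 1 (m + 1), evol (e.flow s) (e.amp (m + 1 - s) 1) =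
      ∑ s ∈ Finset.Icc 1 m, e.flow s (m - s).succPNat := by
    intro e he
    rw [Finset.sum_Icc_succ_top (by omega), Nat.sub_self, he.amp_zero, map_zero, add_zero]
    refine Finset.sum_congr rfl fun s hs => ?_
    have hs2 := (Finset.mem_Icc.mp hs).2
    have h3 : m + 1 - s = ((m - s).succPNat : ℕ) := by
      rw [Nat.succPNat_coe]; omega
    rw [h3, he.amp_one, evol_u]
  rw [h2 he, h2 hf, hω, hmean, hag.amp_eq 1 one_ne_zero, amp_first_eq he, amp_first_eq hf,
    add_sub_add_left_eq_sub, ← Finset.sum_sub_distrib] at h1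
  simp only [sub_self, map_zero, zero_mul, smul_zero, add_zero] at h1
  exact h1

/-- The nonlinear part of a flow that commutes with the linear Schrödinger flow vanishes. -/
theorem eq_zero_of_flow_comm (hh : h ≠ 0) (hκ : Real.sin (κ * h) ≠ 0) {s μ : ℕ} {j : ℕ+}
    (hj : (j : ℕ) ≤ μ) {F G : ℕ+ → DiffPoly}
    (hF : ∀ i : ℕ+, (i : ℕ) ≤ μ → F i = linFlow (burgersB h κ) 2 (u i))
    {p : DiffPoly} (hp : p ∈ P (s + j) j) (hG : G j = linFlow (burgersB h κ) s (u j) + p)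
    (hFG : evol F (G j) = evol G (F j)) : p = 0 := by
  have hB : (burgersB h κ 2 : ℂ) ≠ 0 := by
    rw [burgersB_two]
    exact_mod_cast neg_ne_zero.mpr (div_ne_zero hκ (mul_ne_zero two_ne_zero hh))
  have h1 : evol F p = linFlow (burgersB h κ) 2 p := by
    rw [hF j hj, evol_linFlow, evol_u, hG, map_add, linFlow_add, evol_linFlow, evol_u, hF j hj,
      linFlow_comm] at hFG
    exact add_left_cancel hFG
  rw [evol_congr (mem_P.mp hp).2.1 fun i hi => hF i (hi.trans hj)] at h1
  refine eq_zero_of_schroedinger (l := (-Complex.I) ^ (2 - 1) * (burgersB h κ 2 : ℂ)) ?_ ?_ hp h1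
  · simpa using hB
  · simp

theorem exists_flow_sub {N : ℕ} (he : e.IsBurgersExpansion h κ N) {s : ℕ} {j : ℕ+} (hs : 2 ≤ s)
    (hsj : s + j ≤ N) : ∃ l : ℂ, ∃ p ∈ P (s + j) j,
      e.flow s j - hopfFlow h κ s j = l • dxPow s (u j) + p := by
  obtain ⟨l, hl⟩ := he.flow_form s j hs hsj
  refine ⟨l - (-Complex.I) ^ (s - 1) * (burgersB h κ s : ℂ), _,
    sub_mem hl (forcing_mem_P h κ s j j.pos), ?_⟩
  rw [hopfFlow, linFlow, sub_smul]
  ring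

/-- The next flows. -/
theorem flow_next_eq (hh : h ≠ 0) (hκ : Real.sin (κ * h) ≠ 0) (he : e.IsBurgersExpansion h κ 5)
    {m : ℕ} (hm : m + 1 ≤ 5) (hag : e.AgreesUpTo (hopfExpansion h κ) m) {s : ℕ}
    (hs : s ∈ Finset.Icc 1 m) :
    e.flow s (m - s).succPNat = hopfFlow h κ s (m - s).succPNat := by
  have hsum := sum_flow_eq hh hκ he hm hag
  have h1 : ∀ j, e.flow 1 j = hopfFlow h κ 1 j :=
    flow_one_eq he (isBurgersExpansion_hopfExpansion hh hκ) (by norm_num)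
  have hform : ∀ s ∈ Finset.Icc 1 m, ∃ l : ℂ, ∃ p ∈ P (m + 1) (m - s).succPNat,
      e.flow s (m - s).succPNat - hopfFlow h κ s (m - s).succPNat =
        l • dxPow s (u (m - s).succPNat) + p := by
    intro s hs
    obtain ⟨hs1, hs2⟩ := Finset.mem_Icc.mp hs
    have hsm : s + ((m - s).succPNat : ℕ) = m + 1 := by rw [Nat.succPNat_coe]; omega
    rcases eq_or_ne s 1 with rfl | hs'
    · exact ⟨0, 0, zero_mem _, by rw [h1, sub_self, zero_smul, add_zero]⟩
    · obtain ⟨l, p, hp, hlp⟩ := exists_flow_sub he (s := s) (j := (m - s).succPNat) (by omega)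
        (by omega)
      exact ⟨l, p, hsm ▸ hp, hlp⟩
  choose! l p hp hlp using hform
  -- The jets `∂^s u(m-s+1)` differ for different `s` and the `p s` have no linear monomials, so
  -- each linear coefficient can be read off separately.
  have hl : ∀ s ∈ Finset.Icc 1 m, l s = 0 := by
    intro s hs
    have h2 := congrArg
      (MvPolynomial.coeff (Finsupp.single (((m - s).succPNat, s, false) : Jet) 1)) hsum
    rw [MvPolynomial.coeff_sum, MvPolynomial.coeff_zero, Finset.sum_eq_single s, hlp s hs,
      MvPolynomial.coeff_add, coeff_single_of_mem_P (hp s hs), dxPow_u, MvPolynomial.coeff_smul,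
      MvPolynomial.coeff_X, if_pos rfl, add_zero, smul_eq_mul, mul_one] at h2
    · exact h2
    · intro s' hs' hne
      rw [hlp s' hs', MvPolynomial.coeff_add, coeff_single_of_mem_P (hp s' hs'), dxPow_u,
        MvPolynomial.coeff_smul, MvPolynomial.coeff_X, if_neg, smul_zero, add_zero]
      intro h3
      have h4 := Finsupp.single_left_injective one_ne_zero h3
      exact hne (congrArg (fun v : Jet => v.2.1) h4)
    · exact fun h => absurd hs h
  have hflow : ∀ s ∈ Finset.Icc 1 m, e.flow s (m - s).succPNat =
      hopfFlow h κ s (m - s).succPNat + p s := by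
    intro s hs
    have := hlp s hs
    rw [hl s hs, zero_smul, zero_add] at this
    rw [← this]; ring
  -- For `s ≥ 3` the index `m - s + 1` is at most `m - 2`, so its `t_2`-flow is known from earlier
  -- orders. As `m ≤ 4`, the index is at most 2 and that flow is linear.
  have hother : ∀ s ∈ Finset.Icc 1 m, s ≠ 2 → p s = 0 := by
    intro s hs hs2
    obtain ⟨hs1, hsm⟩ := Finset.mem_Icc.mp hs
    rcases eq_or_ne s 1 with rfl | hs'
    · have := hflow 1 hs
      rw [h1] at this
      exact left_eq_add.mp this
    · have hj : ((m - s).succPNat : ℕ) = m - s + 1 := Nat.succPNat_coe _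
      have hP := hp s hs
      have hsj : m + 1 = s + ((m - s).succPNat : ℕ) := by omega
      rw [hsj] at hP
      refine eq_zero_of_flow_comm hh hκ (le_refl ((m - s).succPNat : ℕ)) (F := e.flow 2)
        (G := e.flow s) (fun i hi => ?_) hP ?_ (he.flow_comm 2 s _ (by norm_num) hs1 (by omega)
          (by omega))
      · rw [hag.flow_eq 2 i (by norm_num) (by omega)]
        exact hopfFlow_of_le h κ 2 (by omega)
      · rw [hflow s hs, hopfFlow_of_le h κ s (by omega)]
  -- Commutation with the `t_2`-flow says nothing about that flow itself, but its term is now alone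
  -- in a vanishing sum.
  have hzero : ∀ s ∈ Finset.Icc 1 m, p s = 0 := by
    intro s hs
    by_cases hs2 : s = 2
    · have h2 : ∀ s ∈ Finset.Icc 1 m,
          e.flow s (m - s).succPNat - hopfFlow h κ s (m - s).succPNat = p s := fun s hs => by
        rw [hflow s hs]; ring
      rw [Finset.sum_congr rfl h2, Finset.sum_eq_single s
        (fun s' hs' hne => hother s' hs' (by omega)) (fun h => absurd hs h)] at hsum
      exact hsum
    · exact hother s hs hs2
  rw [hflow s hs, hzero s hs, add_zero]

/-- Each step settles the mean of order `m`, then the harmonics of order `m + 1`, using reality for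
the negative ones, and the flows with `s + j = m + 1`. The mean lags behind because its derivative
appears only in the equation of the next order. -/
theorem agreesUpTo (hh : h ≠ 0) (hκ : Real.sin (κ * h) ≠ 0) (he : e.IsBurgersExpansion h κ 5) :
    ∀ m ≤ 5, e.AgreesUpTo (hopfExpansion h κ) m := by
  intro m
  have hf := isBurgersExpansion_hopfExpansion hh hκ
  induction m with
  | zero =>
    intro _
    refine ⟨by simp, fun θ _ => by rw [he.amp_zero, hf.amp_zero], fun s j hs hsj => ?_⟩
    omega
  | succ m ih =>
    intro hm
    have hag := ih (by omega)
    refine ⟨fun n hn θ => ?_, fun θ hθ => ?_, fun s j hs hsj => ?_⟩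
    · rcases Nat.lt_succ_iff_lt_or_eq.mp hn with hn | rfl
      · exact hag.amp_lt n hn θ
      · by_cases hθ : θ = 0
        · rw [hθ, amp_mean_eq hh hκ he hm hag]
        · exact hag.amp_eq θ hθ
    · have hpos : ∀ θ : ℤ, 1 ≤ θ → e.amp (m + 1) θ = (hopfExpansion h κ).amp (m + 1) θ := by
        intro θ hθ
        rcases eq_or_lt_of_le hθ with rfl | hθ
        · rw [amp_first_eq he, amp_first_eq hf]
        · exact amp_higher_eq hh hκ he hm hag hθ
      rcases lt_or_gt_of_ne hθ with hθ | hθ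
      · rw [← neg_neg θ, he.amp_neg, hf.amp_neg, hpos _ (by omega)]
      · exact hpos θ hθ
    · rcases Nat.lt_or_ge (s + j) (m + 1) with hlt | hge
      · exact hag.flow_eq s j hs (by omega)
      · have := j.pos
        have hj : j = (m - s).succPNat := by
          refine PNat.coe_injective ?_
          rw [Nat.succPNat_coe]
          omega
        rw [hj]
        exact flow_next_eq hh hκ he hm hag (Finset.mem_Icc.mpr ⟨hs, by omega⟩)

end Uniqueness

/-! ### The main theorem -/

theorem flow_eq {e : Expansion} {h κ : ℝ} (hh : h ≠ 0) (hκ : Real.sin (κ * h) ≠ 0)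
    (he : e.IsBurgersExpansion h κ 5) {s : ℕ} {j : ℕ+} (hs : 1 ≤ s) (hsj : s + j ≤ 5) :
    e.flow s j = linFlow (burgersB h κ) s (u j) + forcing h κ s j :=
  (agreesUpTo hh hκ he 5 le_rfl).flow_eq s j hs hsj

theorem M_forcing (h κ : ℝ) (s : ℕ) {p : DiffPoly} (hp : p ∈ upTo 2) :
    M (burgersB h κ) (forcing h κ) s p = linM (burgersB h κ) s p := by
  rw [M, linM, evol_congr hp fun j hj => ?_]
  exact hopfFlow_of_le h κ s hj

/-- Zero forcing is admissible for `j ≥ 4`, as no evolution equation with `s ≥ 2` reaches these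
indices within order 5. At `j = 3` the forcings are `linM` of one fixed polynomial, hence compatible
for all `s, s'`, including those beyond that order. -/
theorem isAsymptoticallyCIntegrable {e : Expansion} {h κ : ℝ} (hh : h ≠ 0)
    (hκ : Real.sin (κ * h) ≠ 0) (he : e.IsBurgersExpansion h κ 5) {J : ℕ} :
    IsAsymptoticallyCIntegrable e 5 (burgersB h κ) J := by
  refine ⟨forcing h κ, fun s => ?_, fun s j _ hj _ => ?_, fun s j hs _ hsj => ?_,
    fun s s' j _ _ _ _ => ?_⟩
  · rw [forcing, if_neg (by decide)]
  · have : 2 ≤ (j : ℕ) := hj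
    exact forcing_mem_P h κ s j (by omega)
  · exact flow_eq hh hκ he (by omega) hsj
  · have hmem : ∀ s, forcing h κ s j ∈ upTo 2 := fun s =>
      (mem_P.mp (forcing_mem_P h κ s j (by norm_num))).2.1
    rw [M_forcing _ _ _ (hmem s), M_forcing _ _ _ (hmem s')]
    simp only [forcing]
    split_ifs
    · rw [linM_smul, linM_smul, linM_comm]
    · simp [linM, linFlow]

/-- The terms in `∂²u(1)` cancel while those in `∂²ū(1)` double, because the conjugate evolves with
the opposite coefficient. The other terms are the Leibniz cross terms of `∂²`. -/
theorem linM_two_cubic (B : ℕ → ℝ) : linM B 2 cubic = (2 * Complex.I * (B 2 : ℂ)) •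
    ((2 : ℂ) • (dx (u 1) * bar (dx (u 1)) * u 1) + bar (dxPow 2 (u 1)) * u 1 ^ 2 +
      dx (u 1) ^ 2 * bar (u 1)) := by
  have h2 : ∀ p : DiffPoly, dxPow 2 p = dx (dx p) := fun _ => rfl
  have hb : ∀ p : DiffPoly, dx (bar p) = bar (dx p) := dx_bar
  simp only [linM, cubic, linFlow, Derivation.leibniz, evol_bar, evol_u, h2, smul_eq_mul, map_add,
    hb, bar_smul, map_mul, map_neg, Complex.conj_I, Complex.conj_ofReal, Nat.add_one_sub_one,
    pow_one]
  simp only [MvPolynomial.smul_eq_C_mul, map_mul, map_neg, map_ofNat]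
  ring

/-- The coefficients of `f_2(3)`. -/
def burgersTau (h κ : ℝ) (n : ℕ) : ℂ :=
  let c := cubicCoeff h (κ * h) * (2 * Complex.I * (burgersB h κ 2 : ℂ))
  if n = 2 then 2 * c else if n = 4 ∨ n = 5 then c else 0

theorem forcing_eq_forcing23 (h κ : ℝ) : forcing h κ 2 3 = forcing23 (burgersTau h κ) := by
  rw [forcing, if_pos rfl, linM_two_cubic]
  simp [forcing23, burgersTau, MvPolynomial.smul_eq_C_mul]
  ring

/-- The coefficients are unique because `∂²u(1)` and the cubic term are distinct monomials. -/
theorem lowestOrderNLS_iff {e : Expansion} {h κ : ℝ} (hh : h ≠ 0) (hκ : Real.sin (κ * h) ≠ 0)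
    (he : e.IsBurgersExpansion h κ 5) (β ρ : ℂ) :
    LowestOrderNLS e β ρ ↔ β = ((-(Real.sin (κ * h) / (2 * h)) : ℝ) : ℂ) ∧ ρ = 0 := by
  have h1 : Complex.I • e.flow 2 1 = (burgersB h κ 2 : ℂ) • dxPow 2 (u 1) := by
    rw [flow_eq hh hκ he (by norm_num) (by decide), forcing, if_neg (by decide), add_zero, linFlow,
      smul_smul]
    congr 1
    rw [Nat.add_one_sub_one, pow_one]
    linear_combination -(burgersB h κ 2 : ℂ) * Complex.I_mul_I
  rw [LowestOrderNLS, h1, ← burgersB_two]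
  constructor
  · intro h2
    have hcub : u 1 * bar (u 1) * u 1 = MvPolynomial.monomial cubicExponent 1 := cubic_eq_monomial
    rw [hcub, dxPow_u] at h2
    have hne : Finsupp.single ((1, 2, false) : Jet) 1 ≠ cubicExponent := by
      intro h3
      have := DFunLike.congr_fun h3 (1, 2, false)
      simp [cubicExponent] at this
    have h3 := congrArg (MvPolynomial.coeff (Finsupp.single ((1, 2, false) : Jet) 1)) h2
    have h4 := congrArg (MvPolynomial.coeff cubicExponent) h2
    simp only [MvPolynomial.coeff_add, MvPolynomial.coeff_smul, MvPolynomial.coeff_X,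
      MvPolynomial.coeff_monomial, if_neg hne, if_neg hne.symm, smul_eq_mul, if_true, mul_one,
      mul_zero, add_zero, zero_add] at h3 h4
    exact ⟨h3.symm, h4.symm⟩
  · rintro ⟨rfl, rfl⟩
    rw [zero_smul, add_zero]

theorem forcing22_eq_zero_iff (a b : ℂ) : forcing22 a b = 0 ↔ a = 0 ∧ b = 0 := by
  constructor
  · intro h
    set m₁ : Jet →₀ ℕ := Finsupp.single (1, 1, false) 1 + (Finsupp.single (1, 0, false) 1 +
      Finsupp.single (1, 0, true) 1) with hm₁
    set m₂ : Jet →₀ ℕ := Finsupp.single (1, 1, true) 1 + Finsupp.single (1, 0, false) 2 with hm₂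
    have h1 : dx (u 1) * (u 1 * bar (u 1)) = MvPolynomial.monomial m₁ (1 : ℂ) := by
      rw [u, dx_X, bar_X]
      simp [MvPolynomial.X, MvPolynomial.monomial_mul, hm₁]
    have h2 : bar (dx (u 1)) * u 1 ^ 2 = MvPolynomial.monomial m₂ (1 : ℂ) := by
      rw [u, dx_X, bar_X]
      simp [MvPolynomial.X, MvPolynomial.monomial_mul, MvPolynomial.monomial_pow, hm₂]
    have hne : m₁ ≠ m₂ := by
      intro h3
      have := DFunLike.congr_fun h3 (1, 1, false)
      simp [hm₁, hm₂] at this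
    rw [forcing22, h1, h2] at h
    have h3 := congrArg (MvPolynomial.coeff m₁) h
    have h4 := congrArg (MvPolynomial.coeff m₂) h
    simpa [MvPolynomial.coeff_monomial, hne, hne.symm] using And.intro h3 h4
  · rintro ⟨rfl, rfl⟩
    simp [forcing22]

/-- For `a = b = 0` every condition except `τ 1 = 0` is void. -/
theorem a3Conditions_burgersTau (h κ B : ℝ) : A3Conditions B 0 0 (burgersTau h κ) := by
  constructor <;> simp [burgersTau]

end MultiScale

end

theorem mainTheorem1 (h κ : ℝ) (hh : h ≠ 0) (hκ : Real.sin (κ * h) ≠ 0) :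
    (∃ e : MultiScale.Expansion, e.IsBurgersExpansion h κ 5) ∧
    ∃ τ : ℕ → ℂ,
      MultiScale.A3Conditions (-(Real.sin (κ * h) / (2 * h))) 0 0 τ ∧
      ∀ e : MultiScale.Expansion, e.IsBurgersExpansion h κ 5 →
        e.ω = -(Real.sin (κ * h) / h) ∧
        (∀ j, e.flow 1 j = ((Real.cos (κ * h) / h : ℝ) : ℂ) • MultiScale.dx (MultiScale.u j)) ∧
        (∀ β ρ : ℂ, MultiScale.LowestOrderNLS e β ρ ↔
          β = ((-(Real.sin (κ * h) / (2 * h)) : ℝ) : ℂ) ∧ ρ = 0) ∧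
        MultiScale.IsAsymptoticallyCIntegrable e 5 (MultiScale.burgersB h κ) 1 ∧
        MultiScale.IsAsymptoticallyCIntegrable e 5 (MultiScale.burgersB h κ) 2 ∧
        MultiScale.IsAsymptoticallyCIntegrable e 5 (MultiScale.burgersB h κ) 3 ∧
        (∀ a b : ℂ, e.flow 2 2 = MultiScale.linFlow (MultiScale.burgersB h κ) 2 (MultiScale.u 2) +
          MultiScale.forcing22 a b ↔ a = 0 ∧ b = 0) ∧
        e.flow 2 3 = MultiScale.linFlow (MultiScale.burgersB h κ) 2 (MultiScale.u 3) +
          MultiScale.forcing23 τ := by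
  refine ⟨⟨_, MultiScale.isBurgersExpansion_hopfExpansion hh hκ⟩, MultiScale.burgersTau h κ,
    MultiScale.a3Conditions_burgersTau h κ _, fun e he => ?_⟩
  have hf := MultiScale.isBurgersExpansion_hopfExpansion hh hκ
  refine ⟨MultiScale.omega_eq he hf (by norm_num), fun j => ?_,
    MultiScale.lowestOrderNLS_iff hh hκ he, MultiScale.isAsymptoticallyCIntegrable hh hκ he,
    MultiScale.isAsymptoticallyCIntegrable hh hκ he,
    MultiScale.isAsymptoticallyCIntegrable hh hκ he, fun a b => ?_, ?_⟩
  · rw [MultiScale.flow_one_eq he hf (by norm_num), ← MultiScale.burgersB_one]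
    exact MultiScale.hopfFlow_one h κ j
  · rw [MultiScale.flow_eq hh hκ he (by norm_num) (by decide), MultiScale.forcing,
      if_neg (by decide), add_right_inj, eq_comm, MultiScale.forcing22_eq_zero_iff]
  · rw [MultiScale.flow_eq hh hκ he (by norm_num) (by decide), MultiScale.forcing_eq_forcing23]
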